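/- **Setting.** Let $M$ be a smooth manifold (possibly with boundary or corners), $V=\bigoplus_{i\in\mathbb Z}V^i$ a $\mathbb Z$-graded real vector space, and $\underline V$ a local system of graded vector spaces on $M$ with fibres $V_x\cong V$ and flat connection $\nabla$. Put $\mathfrak g_x=\prod_{n\ge 0}\mathrm{Hom}(V_x^{\otimes n},V_x[1-n])$. For homogeneous inputs $a_1,a_2,\dots$ write $\maltese_j=\sum_{i\le j}(|a_i|-1)$. For $f\in\mathrm{Hom}(V_x^{\otimes k},V_x)$ and $g\in\mathrm{Hom}(V_x^{\otimes r},V_x)$ of reduced degrees $\|f\|,\|g\|$ (an element of $\mathrm{Hom}(V_x^{\otimes n},V_x[1-n+e])$ has reduced degree $e$), put $(f\circ g)(a_1,\dots,a_{k+r-1})=\sum_{j=0}^{k-1}(-1)^{\|g\|\maltese_j}f(a_1,\dots,a_j,g(a_{j+1},\dots,a_{j+r}),a_{j+r+1},\dots,a_{k+r-1})$, and $[f,g]=f\circ g-(-1)^{\|f\|\|g\|}g\circ f$. For $\mathfrak g$-valued forms, $[\omega\otimes f,\theta\otimes g]=(-1)^{|\theta|\,\|f\|}\,\omega\wedge\theta\otimes[f,g]$.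 If $V$ is infinite-dimensional, a map into $V$ is called smooth when its composition with every linear functional is smooth (such a map locally has values in a finite-dimensional subspace), vector-valued integrals are defined by pairing with linear functionals, and a $\mathrm{Hom}(V^{\otimes n},V)$-valued map is called smooth when its value on every $n$-tuple of vectors is. Let $\alpha=\sum_{m,n}\alpha^{m,n}$, with $\alpha^{m,n}\in\Omega^m(M;\mathrm{Hom}(\underline V^{\otimes n},\underline V[2-m-n]))$ smooth, satisfy the Maurer–Cartan equation $d_\nabla\alpha+\tfrac12[\alpha,\alpha]=0$ and $\alpha^{0,0}=\alpha^{1,0}=\alpha^{2,0}=0$. For $x\in M$ let $\mathcal A_x$ denote $V_x$ with the operations $\mu_x^n=\alpha_x^{0,n}$. Let $\gamma:[0,1]\to M$ be a $C^1$ path, and choose a graded trivialization of $\gamma^*\underline V$ compatible with the flat connection. In it write $\gamma^*\alpha^{1,r}=A^r_t\,dt$ with $A^r_t:V^{\otimes r}\to V$. For $t_1,\dots,t_i\in[0,1]$, the $(i,n)$-trees at $(t_1,\dots,t_i)$ are the sum of all planar rooted trees with $n$ leaves and $i$ levels, each level carrying exactly one vertex and otherwise identity strands, where the vertex of the $l$-th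 level counted from the leaves, if it has $r\ge1$ incoming edges, is decorated by $A^r_{t_l}$. Equivalently, it is the sum of all maps $V^{\otimes n}\to V$ of the form $$A^{r_i}_{t_i}\circ(1^{\otimes j_{i-1}}\otimes A^{r_{i-1}}_{t_{i-1}}\otimes1\otimes\cdots\otimes1)\circ\cdots\circ(1^{\otimes j_1}\otimes A^{r_1}_{t_1}\otimes1\otimes\cdots\otimes1).$$ The $(0,1)$-tree is the identity, and there is no $(0,n)$-tree for $n\neq1$. For an integer $d\ge0$ and $p,q\in[0,1]$ define, for $n\ge1$, $$\mathcal F^n_{p\to q}=\sum_{i=0}^{n-1+d}(-1)^i\int_{p\le t_1\le\cdots\le t_i\le q}(i,n)\text{-trees}\;dt_1\cdots dt_i ,$$ regarded through the trivialization as a map $V_{\gamma(p)}^{\otimes n}\to V_{\gamma(q)}$. If $p>q$, the inequalities are reversed and the integral is oriented, i.e. it is the iterated integral $\int_p^q\!\int_{t_1}^q\!\cdots\int_{t_{i-1}}^q dt_i\cdots dt_1$. **Theorem.** Suppose $\alpha^{1,1}=0$. Then for all $p,q\in[0,1]$ and every $d\ge 0$ the maps $\mathcal F^n_{p\to q}$,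 $n\ge 1$, are well-defined multilinear maps and form an $A_\infty$ morphism $\mathcal A_{\gamma(p)}\to\mathcal A_{\gamma(q)}$. That is, $\mathcal A_{\gamma(p)}$ and $\mathcal A_{\gamma(q)}$ are $A_\infty$ algebras: at $x=\gamma(p)$ and $x=\gamma(q)$, $\mu_x^n$ has degree $2-n$ and $\sum_{k+r=n+1}\sum_{j=0}^{k-1}(-1)^{\maltese_j}\mu_x^k(a_1,\dots,a_j,\mu_x^r(a_{j+1},\dots,a_{j+r}),a_{j+r+1},\dots,a_n)=0$ for all $n\ge0$. Moreover $\mathcal F^n=\mathcal F^n_{p\to q}$ has degree $1-n$, and for all $n\ge1$ and all homogeneous $a_1,\dots,a_n\in V_{\gamma(p)}$ $$\sum_{\substack{1\le r\le n\\ s_1+\cdots+s_r=n,\ s_i\ge1}}\mu^r_{\gamma(q)}\big(\mathcal F^{s_1}(a_1,\dots,a_{s_1}),\dots,\mathcal F^{s_r}(a_{n-s_r+1},\dots,a_n)\big)=\sum_{m=1}^n\sum_{j=0}^{n-m}(-1)^{\maltese_j}\mathcal F^{n-m+1}\big(a_1,\dots,a_j,\mu^m_{\gamma(p)}(a_{j+1},\dots,a_{j+m}),a_{j+m+1},\dots,a_n\big).$$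 -/

import Mathlib

open scoped Manifold ContDiff Topology

noncomputable section

namespace AInfFamily

/-! ### Operations on multilinear maps

Finite tuples of inputs `a₁, …, aₙ` are given as the first `n` terms of a sequence `a : ℕ → V`
(zero-based), with degrees `deg : ℕ → ℤ`. A `ℤ`-graded vector space is a real vector space `V` with
subspaces `𝒱 i`, `i : ℤ`, of which it is the internal direct sum. -/

section Multilinear

variable {V : Type*} [AddCommGroup V] [Module ℝ V] {W : Type*} [AddCommGroup W] [Module ℝ W]

/-- `f : V^{⊗ n} → W[k]`, that is, `f` raises the total degree by `k`. -/
def IsHomogeneous (𝒱 : ℤ → Submodule ℝ V) (𝒲 : ℤ → Submodule ℝ W) {n : ℕ}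
    (f : MultilinearMap ℝ (fun _ : Fin n => V) W) (k : ℤ) : Prop :=
  ∀ (deg : Fin n → ℤ) (a : Fin n → V), (∀ i, a i ∈ 𝒱 (deg i)) → f a ∈ 𝒲 ((∑ i, deg i) + k)

/-- The reduced degree `∑_{i ≤ j} (|a_i| - 1)` of the first `j` inputs. -/
def maltese (deg : ℕ → ℤ) (j : ℕ) : ℤ := ∑ i ∈ Finset.range j, (deg i - 1)

/-- `(a₁, …, a_j, x, a_{j+r+1}, a_{j+r+2}, …)`: the `r` entries after the first `j` are replaced
by the single entry `x`. -/
def insertAt (a : ℕ → V) (j r : ℕ) (x : V) : ℕ → V :=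
  fun i => if i < j then a i else if i = j then x else a (i + r - 1)

/-- The Gerstenhaber composition
`∑_j (-1)^{e ✠_j} f(a₁, …, a_j, g(a_{j+1}, …, a_{j+r}), a_{j+r+1}, …, a_{k+r-1})`
where `e` is the reduced degree of `g`. -/
def gComp {k r : ℕ} (f : MultilinearMap ℝ (fun _ : Fin k => V) W)
    (g : MultilinearMap ℝ (fun _ : Fin r => V) V) (e : ℤ) (deg : ℕ → ℤ) (a : ℕ → V) : W :=
  ∑ j ∈ Finset.range k, (-1 : ℝ) ^ (e * maltese deg j) •
    f (fun i : Fin k => insertAt a j r (g fun i : Fin r => a (j + i)) i)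

/-- The Gerstenhaber bracket `f ∘ g - (-1)^{e_f e_g} g ∘ f`, where `e_f`, `e_g` are the reduced
degrees of `f` and `g`. -/
def gBracket {k r : ℕ} (f : MultilinearMap ℝ (fun _ : Fin k => V) V)
    (g : MultilinearMap ℝ (fun _ : Fin r => V) V) (ef eg : ℤ) (deg : ℕ → ℤ) (a : ℕ → V) : V :=
  gComp f g eg deg a - (-1 : ℝ) ^ (ef * eg) • gComp g f ef deg a

/-- The maps `μ n : V^{⊗ n} → V[2 - n]`, `n ≥ 0`, form an A∞ algebra. -/
structure IsAInfAlgebra (𝒱 : ℤ → Submodule ℝ V)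
    (μ : ∀ n, MultilinearMap ℝ (fun _ : Fin n => V) V) : Prop where
  internal : DirectSum.IsInternal 𝒱
  homogeneous : ∀ n : ℕ, IsHomogeneous 𝒱 𝒱 (μ n) (2 - n)
  relation : ∀ (n : ℕ) (deg : ℕ → ℤ) (a : ℕ → V), (∀ i, a i ∈ 𝒱 (deg i)) →
    ∑ kr ∈ Finset.HasAntidiagonal.antidiagonal (n + 1), gComp (μ kr.1) (μ kr.2) 1 deg a = 0

/-- The maps `F n : V^{⊗ n} → W[1 - n]`, `n ≥ 1`, form an A∞ morphism from `(V, μA)` to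
`(W, μB)`. The value `F 0` is irrelevant. The sum on the left is over all `r` and all
`s₁ + ⋯ + s_r = n` with `s_i ≥ 1`. -/
structure IsAInfMorphism (𝒱 : ℤ → Submodule ℝ V) (𝒲 : ℤ → Submodule ℝ W)
    (μA : ∀ n, MultilinearMap ℝ (fun _ : Fin n => V) V)
    (μB : ∀ n, MultilinearMap ℝ (fun _ : Fin n => W) W)
    (F : ∀ n, MultilinearMap ℝ (fun _ : Fin n => V) W) : Prop where
  source : IsAInfAlgebra 𝒱 μA
  target : IsAInfAlgebra 𝒲 μB
  homogeneous : ∀ n : ℕ, 1 ≤ n → IsHomogeneous 𝒱 𝒲 (F n) (1 - n)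
  relation : ∀ n : ℕ, 1 ≤ n → ∀ (deg : ℕ → ℤ) (a : ℕ → V), (∀ i, a i ∈ 𝒱 (deg i)) →
    ∑ c : Composition n, μB c.length
        (fun i => F (c.blocksFun i) (fun l => a (c.embedding i l))) =
      ∑ m ∈ Finset.Icc 1 n, gComp (F (n - m + 1)) (μA m) 1 deg a

/-- The sum of all `(k, n)`-trees with vertices labelled by `A`: rooted planar trees with `n`
leaves and `k` levels, each level carrying exactly one vertex (the remaining strands are
identities). The vertex of the `l`-th level, counted from the leaves, is decorated by
`A (t l) r`, where `r ≥ 1` is its number of incoming edges; the tree is evaluated on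
`a₁ ⊗ ⋯ ⊗ aₙ`. The `(0, 1)`-tree is the identity and there are no `(0, n)`-trees for `n ≠ 1`. The
recursion is over the position `j` and the arity `r` of the vertex next to the leaves. -/
def treeSum (A : ℝ → ∀ r : ℕ, MultilinearMap ℝ (fun _ : Fin r => V) V) :
    (k n : ℕ) → (Fin k → ℝ) → (ℕ → V) → V
  | 0, n, _, a => if n = 1 then a 0 else 0
  | k + 1, n, t, a => ∑ r ∈ Finset.Icc 1 n, ∑ j ∈ Finset.range (n - r + 1),
      treeSum A k (n - r + 1) (Fin.tail t)
        (insertAt a j r (A (t 0) r fun i : Fin r => a (j + i)))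

end Multilinear

/-- The iterated integral `∫_{p ≤ t₁ ≤ ⋯ ≤ t_k ≤ q} g(t₁, …, t_k)`. For `p > q` it is the oriented
integral over the simplex `p ≥ t₁ ≥ ⋯ ≥ t_k ≥ q`. -/
def simplexIntegral : (k : ℕ) → (p q : ℝ) → ((Fin k → ℝ) → ℝ) → ℝ
  | 0, _, _, g => g Fin.elim0
  | k + 1, p, q, g => ∫ s in p..q, simplexIntegral k s q fun t => g (Fin.cons s t)

/-! ### Local systems, forms and the Maurer–Cartan equation -/

/-- A local system of graded vector spaces on `M` with fibres isomorphic to `(V, 𝒱)`: local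
trivialisations over an open cover, with locally constant transition functions. (The value of
`triv b x` is irrelevant for `x ∉ baseSet b`.) -/
structure LocalSystem (M : Type*) [TopologicalSpace M] {V : Type*} [AddCommGroup V] [Module ℝ V]
    (𝒱 : ℤ → Submodule ℝ V) where
  fiber : M → Type*
  [addCommGroup : ∀ x, AddCommGroup (fiber x)]
  [module : ∀ x, Module ℝ (fiber x)]
  grading : ∀ x, ℤ → Submodule ℝ (fiber x)
  ι : Type*
  baseSet : ι → Set M
  isOpen_baseSet : ∀ b, IsOpen (baseSet b)
  exists_mem_baseSet : ∀ x, ∃ b, x ∈ baseSet b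
  triv : ι → ∀ x, fiber x ≃ₗ[ℝ] V
  triv_mem_iff : ∀ b, ∀ x ∈ baseSet b, ∀ (i : ℤ) (v : fiber x),
    triv b x v ∈ 𝒱 i ↔ v ∈ grading x i
  locallyConstant : ∀ b b', ∀ x ∈ baseSet b ∩ baseSet b', ∀ᶠ y in 𝓝 x, ∀ v : V,
    triv b' y ((triv b y).symm v) = triv b' x ((triv b x).symm v)

attribute [instance] LocalSystem.addCommGroup LocalSystem.module

section Forms

variable {E : Type*} [NormedAddCommGroup E] [NormedSpace ℝ E]
  {H : Type*} [TopologicalSpace H] (I : ModelWithCorners ℝ E H)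
  {M : Type*} [TopologicalSpace M] [ChartedSpace H M]
  {V : Type*} [AddCommGroup V] [Module ℝ V] {𝒱 : ℤ → Submodule ℝ V}

/-- A (not necessarily smooth) differential form on `M` with values in the Hochschild cochains of
the fibres, by components: `α m n` is an `m`-form with values in
`Hom(fiber^{⊗ n}, fiber)`. -/
abbrev HochschildForm (L : LocalSystem M 𝒱) :=
  ∀ (m n : ℕ) (x : M),
    TangentSpace I x [⋀^Fin m]→ₗ[ℝ] MultilinearMap ℝ (fun _ : Fin n => L.fiber x) (L.fiber x)

variable {I} {L : LocalSystem M 𝒱}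

/-- The real `m`-form `⟨φ, α^{m,n}(a₁, …, aₙ)⟩`, where the fibres are identified with `V` by the flat
trivialisation `b`, written in the chart at `x`. -/
def localForm (α : HochschildForm I L) (m n : ℕ) (b : L.ι) (x : M) (φ : Module.Dual ℝ V)
    (a : Fin n → V) (e : E) (v : Fin m → E) : ℝ :=
  φ (L.triv b ((extChartAt I x).symm e)
    (α m n ((extChartAt I x).symm e)
      (fun i => mfderivWithin 𝓘(ℝ, E) I (extChartAt I x).symm (Set.range I) e (v i))
      (fun i => (L.triv b ((extChartAt I x).symm e)).symm (a i))))

/-- Smoothness of the components of `α`. A map into a real vector space without topology (here `V`,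
possibly of infinite dimension) is smooth when its composition with every linear functional is;
such a map has locally values in a finite-dimensional subspace. A map into
`Hom(V^{⊗ n}, V)` is smooth when its value at every `n`-tuple of vectors is. -/
def IsSmooth (α : HochschildForm I L) : Prop :=
  ∀ (m n : ℕ) (b : L.ι), ∀ x ∈ L.baseSet b, ∀ (φ : Module.Dual ℝ V) (a : Fin n → V)
    (v : Fin m → E),
    ContDiffWithinAt ℝ ∞ (fun e => localForm α m n b x φ a e v) (Set.range I) (extChartAt I x x)

/-- The `m`-form component of the covariant exterior derivative `d_∇ α` at `x`, evaluated on
`n` inputs and paired with `φ`: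
`dω(v₀, …, v_m) = ∑_i (-1)^i ∂_{v_i} ω(v₀, …, v̂_i, …, v_m)` in the chart at `x`. -/
def covariantDeriv (α : HochschildForm I L) : (m n : ℕ) → (b : L.ι) → (x : M) →
    (φ : Module.Dual ℝ V) → (a : Fin n → V) → (v : Fin m → TangentSpace I x) → ℝ
  | 0, _, _, _, _, _, _ => 0
  | m + 1, n, b, x, φ, a, v =>
    let w : Fin (m + 1) → E := fun i => mfderiv I 𝓘(ℝ, E) (extChartAt I x) x (v i)
    ∑ i : Fin (m + 1), (-1 : ℝ) ^ (i : ℕ) *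
      fderivWithin ℝ (fun e => localForm α m n b x φ a e (w ∘ i.succAbove)) (Set.range I)
        (extChartAt I x x) (w i)

/-- The `(m, n)` component of the bracket `[α, α]` at `x`, evaluated on tangent vectors `v` and on
homogeneous inputs `a` of degrees `deg`. The bracket of `ω ⊗ f` and `θ ⊗ g` is
`(-1)^{|θ| e_f} ω ∧ θ ⊗ [f, g]`, and
`(ω ∧ θ)(v) = (m₁! m₂!)⁻¹ ∑_σ sgn(σ) ω(v_{σ(1)}, …, v_{σ(m₁)}) θ(v_{σ(m₁+1)}, …, v_{σ(m)})`.
As `α` has total degree one, `α^{m₁,k}` has reduced degree `1 - m₁`. -/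
def selfBracket (α : HochschildForm I L) (m n : ℕ) (x : M) (v : Fin m → TangentSpace I x)
    (deg : ℕ → ℤ) (a : ℕ → L.fiber x) : L.fiber x :=
  ∑ p : Fin (m + 1), ∑ kr ∈ Finset.HasAntidiagonal.antidiagonal (n + 1),
    (((p : ℕ).factorial * (m - (p : ℕ)).factorial : ℕ) : ℝ)⁻¹ •
      ∑ σ : Equiv.Perm (Fin m), ((Equiv.Perm.sign σ : ℤ) : ℝ) •
        (-1 : ℝ) ^ (((m : ℤ) - (p : ℕ)) * (1 - (p : ℕ))) •
          gBracket
            (α (p : ℕ) kr.1 x fun i => v (σ ⟨i, by omega⟩))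
            (α (m - (p : ℕ)) kr.2 x fun i => v (σ ⟨(p : ℕ) + i, by omega⟩))
            (1 - (p : ℕ)) (1 - ((m : ℤ) - (p : ℕ))) deg a

/-- `α` is a smooth form of total degree one, `α^{m,n} ∈ Ω^m(M; Hom(V^{⊗ n}, V[2 - m - n]))`, that
solves the Maurer–Cartan equation `d_∇ α + ½ [α, α] = 0`. -/
structure IsMaurerCartan (α : HochschildForm I L) : Prop where
  smooth : IsSmooth α
  homogeneous : ∀ (m n : ℕ) (x : M) (v : Fin m → TangentSpace I x),
    IsHomogeneous (L.grading x) (L.grading x) (α m n x v) (2 - m - n)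
  equation : ∀ (m n : ℕ) (b : L.ι), ∀ x ∈ L.baseSet b, ∀ (φ : Module.Dual ℝ V)
    (deg : ℕ → ℤ) (a : ℕ → V), (∀ i, a i ∈ 𝒱 (deg i)) → ∀ v : Fin m → TangentSpace I x,
    covariantDeriv α m n b x φ (fun i => a i) v +
      (1 / 2 : ℝ) * φ (L.triv b x
        (selfBracket α m n x v deg fun i => (L.triv b x).symm (a i))) = 0

/-- The structure maps `μ^n_x = α^{0,n}_x` of the A∞ algebra over `x`. -/
def structureMaps (α : HochschildForm I L) (x : M) (n : ℕ) :
    MultilinearMap ℝ (fun _ : Fin n => L.fiber x) (L.fiber x) :=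
  α 0 n x Fin.elim0

/-- A trivialisation of the pull-back of `L` along the path `γ : [0, 1] → M` that is compatible
with the grading and with the flat connection. (Values outside `[0, 1]` are irrelevant.) -/
structure FlatTrivialization (L : LocalSystem M 𝒱) (γ : ℝ → M) where
  toEquiv : ∀ t : ℝ, L.fiber (γ t) ≃ₗ[ℝ] V
  mem_iff : ∀ t ∈ Set.Icc (0 : ℝ) 1, ∀ (i : ℤ) (v : L.fiber (γ t)),
    toEquiv t v ∈ 𝒱 i ↔ v ∈ L.grading (γ t) i
  flat : ∀ b, ∀ t ∈ Set.Icc (0 : ℝ) 1, γ t ∈ L.baseSet b →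
    ∀ᶠ s in 𝓝[Set.Icc (0 : ℝ) 1] t, ∀ v : V,
      L.triv b (γ s) ((toEquiv s).symm v) = L.triv b (γ t) ((toEquiv t).symm v)

/-- The coefficient `α^{1,r}_t : V^{⊗ r} → V` of `dt` in the pull-back of `α^{1,r}` along `γ`, in the
trivialisation `ψ`. -/
def pullbackOne (α : HochschildForm I L) (γ : ℝ → M) (ψ : FlatTrivialization L γ) (t : ℝ) (r : ℕ) :
    MultilinearMap ℝ (fun _ : Fin r => V) V :=
  (ψ.toEquiv t).toLinearMap.compMultilinearMap
    ((α 1 r (γ t) fun _ => mfderivWithin 𝓘(ℝ, ℝ) I γ (Set.Icc 0 1) t (1 : ℝ)).compLinearMap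
      fun _ => (ψ.toEquiv t).symm.toLinearMap)

/-- The maps `F n` from the fibre over `γ p` to the fibre over `γ q` are, in the trivialisation `ψ`,
`F^n = ∑_{i=0}^{n-1+d} (-1)^i ∫_{p ≤ t₁ ≤ ⋯ ≤ t_i ≤ q} (i, n)-trees`, for `n ≥ 1`.
The integral of a `V`-valued function is the vector whose pairing with each linear functional is
the integral of the pairing; there is at most one. -/
def IsTreeIntegral (α : HochschildForm I L) (γ : ℝ → M) (ψ : FlatTrivialization L γ) (d : ℕ)
    (p q : ℝ)
    (F : ∀ n, MultilinearMap ℝ (fun _ : Fin n => L.fiber (γ p)) (L.fiber (γ q))) : Prop :=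
  ∀ n : ℕ, 1 ≤ n → ∀ (a : ℕ → L.fiber (γ p)) (φ : Module.Dual ℝ V),
    φ (ψ.toEquiv q (F n fun i => a i)) =
      ∑ i ∈ Finset.range (n + d), (-1 : ℝ) ^ i * simplexIntegral i p q fun t =>
        φ (treeSum (pullbackOne α γ ψ) i n t fun j => ψ.toEquiv p (a j))

end Forms

end AInfFamily

end

/-!
Along a path, in a flat trivialization, write `A_t dt` for the pull-back of `α^{1,•}` and `μ_t`
for the operations of the fibre. A function of finite lists of vectors stands for a family of
multilinear maps, and `μ ∘ Â` denotes the sum over all ways of inserting `A` into `μ`; it is `μ`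
composed with the coderivation `Â` of the bar construction. The form degree one part of the
Maurer–Cartan equation says `μ_t' = μ_t ∘ Â_t - A_t ∘ μ̂_t`.

Splitting off the vertex next to the leaves shows that the alternating sums of tree integrals
solve `∂_p F_{p → q} = F_{p → q} ∘ Â_p` with `F_{q → q} = id`. Since the commutator of
coderivations is the coderivation of the commutator, the defect `D_t = μ_q ∘ F_{t → q} - F_{t → q}
∘ μ̂_t` solves the same homogeneous equation `D_t' = D_t ∘ Â_t`, and `D_q = 0`. Because `A^1 = 0`,
inserting `A_t` shortens lists, so that `D_t = 0` follows by induction on the number of inputs: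
the derivative of `D_t` on `n` inputs only involves `D_t` on fewer inputs. For the same reason
only trees with fewer than `n` levels contribute to `F^n`.

Weak integrals exist since a weakly continuous map on a compact set has values in a
finite-dimensional subspace.
-/

noncomputable section

namespace AInfFamily

/-! ### Weak calculus in vector spaces without topology -/

section WeakCalculus

variable {V : Type*} [AddCommGroup V] [Module ℝ V] {W : Type*} [AddCommGroup W] [Module ℝ W]

/-- Continuity on `s` of a map into a real vector space without topology, tested against all linear
functionals. -/
def WeaklyContinuousOn {X : Type*} [TopologicalSpace X] (f : X → V) (s : Set X) : Prop :=
  ∀ φ : Module.Dual ℝ V, ContinuousOn (fun x => φ (f x)) s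

/-- `f'` is the derivative of `f` within `s`, tested against all linear functionals. -/
def HasWeakDerivOn (f f' : ℝ → V) (s : Set ℝ) : Prop :=
  ∀ φ : Module.Dual ℝ V, ∀ t ∈ s, HasDerivWithinAt (fun t => φ (f t)) (φ (f' t)) s t

theorem eq_of_forall_dual_eq {x y : V} (h : ∀ φ : Module.Dual ℝ V, φ x = φ y) : x = y :=
  Module.eval_apply_injective ℝ (LinearMap.ext h)

theorem finiteDimensional_span_of_bounded {X : Type*} {f : X → V}
    (hf : ∀ φ : Module.Dual ℝ V, BddAbove (Set.range fun x => φ (f x))) :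
    FiniteDimensional ℝ (Submodule.span ℝ (Set.range f)) := by
  obtain ⟨κ, a, -, hspan, hlin⟩ := exists_linearIndependent' ℝ f
  rw [← hspan]
  suffices Finite κ from FiniteDimensional.span_of_finite ℝ (Set.finite_range _)
  by_contra hκ
  rw [not_finite_iff_infinite] at hκ
  -- A functional with values `0, 1, 2, …` on infinitely many independent vectors is unbounded.
  have hli := hlin.comp _ (Infinite.natEmbedding κ).injective
  obtain ⟨φ, hφ⟩ := ((Module.Basis.span hli).constr ℝ fun k : ℕ => (k : ℝ)).exists_extend
  have hval (k : ℕ) : φ (f (a (Infinite.natEmbedding κ k))) = k := by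
    have := LinearMap.congr_fun hφ (Module.Basis.span hli k)
    rwa [Module.Basis.constr_basis, LinearMap.comp_apply, Submodule.subtype_apply,
      Module.Basis.span_apply] at this
  obtain ⟨C, hC⟩ := hf φ
  obtain ⟨k, hk⟩ := exists_nat_gt C
  exact (hC ⟨_, hval k⟩).not_gt hk

theorem exists_finite_expansion_of_bounded {X : Type*} {f : X → V}
    (hf : ∀ φ : Module.Dual ℝ V, BddAbove (Set.range fun x => φ (f x))) :
    ∃ (n : ℕ) (φ : Fin n → Module.Dual ℝ V) (w : Fin n → V),
      ∀ x, f x = ∑ i, φ i (f x) • w i := by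
  have := finiteDimensional_span_of_bounded hf
  set S := Submodule.span ℝ (Set.range f)
  obtain ⟨P, hP⟩ := S.subtype.exists_leftInverse_of_injective S.ker_subtype
  let b := Module.finBasis ℝ S
  refine ⟨_, fun i => b.coord i ∘ₗ P, fun i => b i, fun x => ?_⟩
  have hx : f x ∈ S := Submodule.subset_span ⟨x, rfl⟩
  have hPx : P (f x) = ⟨f x, hx⟩ := LinearMap.congr_fun hP ⟨f x, hx⟩
  simpa only [LinearMap.comp_apply, hPx, Module.Basis.coord_apply, map_sum, map_smul,
    Submodule.subtype_apply] using (congrArg S.subtype (b.sum_repr ⟨f x, hx⟩)).symm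

namespace WeaklyContinuousOn

variable {X : Type*} [TopologicalSpace X] {f g : X → V} {s : Set X}

theorem const (v : V) : WeaklyContinuousOn (fun _ : X => v) s := fun _ => continuousOn_const

theorem sum {ι : Type*} {u : Finset ι} {f : ι → X → V} (hf : ∀ i ∈ u, WeaklyContinuousOn (f i) s) :
    WeaklyContinuousOn (fun x => ∑ i ∈ u, f i x) s :=
  fun φ => by simpa only [map_sum] using continuousOn_finsetSum u fun i hi => hf i hi φ

theorem congr (hf : WeaklyContinuousOn f s) (h : Set.EqOn g f s) : WeaklyContinuousOn g s :=
  fun φ => (hf φ).congr fun _ hx => congrArg φ (h hx)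

theorem mono {t : Set X} (hf : WeaklyContinuousOn f s) (h : t ⊆ s) : WeaklyContinuousOn f t :=
  fun φ => (hf φ).mono h

theorem exists_expansion (hs : IsCompact s) (hf : WeaklyContinuousOn f s) :
    ∃ (n : ℕ) (φ : Fin n → Module.Dual ℝ V) (w : Fin n → V),
      ∀ x ∈ s, f x = ∑ i, φ i (f x) • w i := by
  obtain ⟨n, φ, w, h⟩ := exists_finite_expansion_of_bounded (f := fun x : s => f x) fun φ => by
    simpa only [Set.image_eq_range] using hs.bddAbove_image (hf φ)
  exact ⟨n, φ, w, fun x hx => h ⟨x, hx⟩⟩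

theorem apply (hs : IsCompact s) {B : X → V → W} (hlin : ∀ x ∈ s, IsLinearMap ℝ (B x))
    (hB : ∀ v, WeaklyContinuousOn (fun x => B x v) s) (hf : WeaklyContinuousOn f s) :
    WeaklyContinuousOn (fun x => B x (f x)) s := by
  obtain ⟨n, χ, w, h⟩ := hf.exists_expansion hs
  have hsum : WeaklyContinuousOn (fun x => ∑ i, χ i (f x) • B x (w i)) s := .sum fun i _ φ => by
    simpa only [map_smul] using (hf (χ i)).fun_smul (hB (w i) φ)
  refine hsum.congr fun x hx => ?_
  change (hlin x hx).mk' _ (f x) = ∑ i, χ i (f x) • (hlin x hx).mk' _ (w i)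
  conv_lhs => rw [h x hx]
  simp only [map_sum, map_smul]

end WeaklyContinuousOn

namespace HasWeakDerivOn

variable {f f' g g' : ℝ → V} {s : Set ℝ}

theorem weaklyContinuousOn (hf : HasWeakDerivOn f f' s) : WeaklyContinuousOn f s :=
  fun φ t ht => (hf φ t ht).continuousWithinAt

theorem const (x : V) : HasWeakDerivOn (fun _ => x) (fun _ => 0) s := fun φ t _ => by
  simpa only [map_zero] using hasDerivWithinAt_const t s (φ x)

theorem add (hf : HasWeakDerivOn f f' s) (hg : HasWeakDerivOn g g' s) :
    HasWeakDerivOn (fun t => f t + g t) (fun t => f' t + g' t) s :=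
  fun φ t ht => by simpa only [map_add] using (hf φ t ht).fun_add (hg φ t ht)

theorem sub (hf : HasWeakDerivOn f f' s) (hg : HasWeakDerivOn g g' s) :
    HasWeakDerivOn (fun t => f t - g t) (fun t => f' t - g' t) s :=
  fun φ t ht => by simpa only [map_sub] using (hf φ t ht).fun_sub (hg φ t ht)

theorem sum {ι : Type*} {u : Finset ι} {f f' : ι → ℝ → V}
    (hf : ∀ i ∈ u, HasWeakDerivOn (f i) (f' i) s) :
    HasWeakDerivOn (fun t => ∑ i ∈ u, f i t) (fun t => ∑ i ∈ u, f' i t) s :=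
  fun φ t ht => by
    simpa only [map_sum] using HasDerivWithinAt.fun_sum fun i hi => hf i hi φ t ht

theorem congr (hf : HasWeakDerivOn f f' s) (h : Set.EqOn g f s) (h' : Set.EqOn g' f' s) :
    HasWeakDerivOn g g' s := fun φ t ht => by
  rw [h' ht]
  exact (hf φ t ht).congr_of_mem (fun r hr => congrArg φ (h hr)) ht

theorem map (hf : HasWeakDerivOn f f' s) (g : V →ₗ[ℝ] W) :
    HasWeakDerivOn (fun t => g (f t)) (fun t => g (f' t)) s :=
  fun φ => hf (φ ∘ₗ g)

theorem deriv_eq_sum (hf : HasWeakDerivOn f f' s) {n : ℕ} {φ : Fin n → Module.Dual ℝ V}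
    {w : Fin n → V} (h : ∀ t ∈ s, f t = ∑ i, φ i (f t) • w i) {t : ℝ} (ht : t ∈ s)
    (hu : UniqueDiffWithinAt ℝ s t) : f' t = ∑ i, φ i (f' t) • w i := by
  refine eq_of_forall_dual_eq fun χ => hu.eq_deriv s (hf χ t ht) ?_
  have hsum : HasWeakDerivOn (fun t => ∑ i, φ i (f t) • w i) (fun t => ∑ i, φ i (f' t) • w i) s :=
    .sum fun i _ => hf.map ((φ i).smulRight (w i))
  exact hsum.congr h (fun _ _ => rfl) χ t ht

theorem apply (hs : IsCompact s) {B B' : ℝ → V → W} (hlin : ∀ t ∈ s, IsLinearMap ℝ (B t))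
    (hlin' : ∀ t ∈ s, IsLinearMap ℝ (B' t))
    (hB : ∀ x, HasWeakDerivOn (fun t => B t x) (fun t => B' t x) s) (hf : HasWeakDerivOn f f' s) :
    HasWeakDerivOn (fun t => B t (f t)) (fun t => B' t (f t) + B t (f' t)) s := by
  obtain ⟨n, χ, w, h⟩ := hf.weaklyContinuousOn.exists_expansion hs
  intro φ t ht
  by_cases hacc : AccPt t (Filter.principal s)
  swap
  · exact HasFDerivWithinAt.of_not_accPt hacc
  have h' := hf.deriv_eq_sum h ht (uniqueDiffWithinAt_iff_accPt.2 hacc)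
  have hsum : HasDerivWithinAt (fun t => ∑ i, χ i (f t) * φ (B t (w i)))
      (∑ i, (χ i (f' t) * φ (B t (w i)) + χ i (f t) * φ (B' t (w i)))) s t :=
    .fun_sum fun i _ => (hf (χ i) t ht).mul (hB (w i) φ t ht)
  refine (hsum.congr_of_mem (fun r hr => ?_) ht).congr_deriv ?_
  · change φ ((hlin r hr).mk' _ (f r)) = ∑ i, χ i (f r) * φ ((hlin r hr).mk' _ (w i))
    conv_lhs => rw [h r hr]
    simp only [map_sum, map_smul, smul_eq_mul]
  · change _ = φ ((hlin' t ht).mk' _ (f t) + (hlin t ht).mk' _ (f' t))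
    conv_rhs => rw [h t ht, h']
    simp only [map_add, map_sum, map_smul, smul_eq_mul, Finset.sum_add_distrib,
      IsLinearMap.mk'_apply, add_comm]

theorem eq_of_deriv_eq_zero (hs : Convex ℝ s) (hf : HasWeakDerivOn f f' s)
    (h0 : ∀ t ∈ s, f' t = 0) {p q : ℝ} (hp : p ∈ s) (hq : q ∈ s) : f p = f q := by
  refine eq_of_forall_dual_eq fun φ => ?_
  have := hs.norm_image_sub_le_of_norm_hasDerivWithin_le (C := 0) (fun t ht => hf φ t ht)
    (fun t ht => by rw [h0 t ht, map_zero, norm_zero]) hq hp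
  simpa only [zero_mul, norm_le_zero_iff, sub_eq_zero] using this

end HasWeakDerivOn

/-- The integral `∫_p^q f` of a map into a real vector space without topology: the vector that
pairs with every linear functional to the integral of the pairing (arbitrary if there is none). -/
def weakIntegral (p q : ℝ) (f : ℝ → V) : V :=
  Classical.epsilon fun v => ∀ φ : Module.Dual ℝ V, φ v = ∫ s in p..q, φ (f s)

theorem weakIntegral_eq_of_forall {p q : ℝ} {f : ℝ → V} {v : V}
    (hv : ∀ φ : Module.Dual ℝ V, φ v = ∫ s in p..q, φ (f s)) : weakIntegral p q f = v :=
  eq_of_forall_dual_eq fun φ => (Classical.epsilon_spec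
    (p := fun v => ∀ φ : Module.Dual ℝ V, φ v = ∫ s in p..q, φ (f s)) ⟨v, hv⟩ φ).trans (hv φ).symm

theorem weakIntegral_congr {p q : ℝ} {f g : ℝ → V} (h : Set.EqOn f g (Set.uIcc p q)) :
    weakIntegral p q f = weakIntegral p q g := by
  have hφ (φ : Module.Dual ℝ V) : ∫ s in p..q, φ (f s) = ∫ s in p..q, φ (g s) :=
    intervalIntegral.integral_congr fun s hs => congrArg φ (h hs)
  simp only [weakIntegral, hφ]

theorem weakIntegral_self (p : ℝ) (f : ℝ → V) : weakIntegral p p f = 0 :=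
  weakIntegral_eq_of_forall fun φ => by rw [map_zero, intervalIntegral.integral_same]

namespace WeaklyContinuousOn

variable {p q : ℝ} {f g : ℝ → V}

theorem dual_weakIntegral (hf : WeaklyContinuousOn f (Set.uIcc p q)) (φ : Module.Dual ℝ V) :
    φ (weakIntegral p q f) = ∫ s in p..q, φ (f s) := by
  obtain ⟨n, χ, w, h⟩ := hf.exists_expansion isCompact_uIcc
  have hpair (φ : Module.Dual ℝ V) :
      φ (∑ i, (∫ s in p..q, χ i (f s)) • w i) = ∫ s in p..q, φ (f s) := by
    have hφ : ∫ s in p..q, φ (f s) = ∫ s in p..q, ∑ i, χ i (f s) * φ (w i) :=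
      intervalIntegral.integral_congr fun s hs => by
        conv_lhs => rw [h s hs]
        simp only [map_sum, map_smul, smul_eq_mul]
    rw [hφ, intervalIntegral.integral_finsetSum fun i _ =>
      (hf (χ i)).intervalIntegrable.mul_const _]
    simp only [map_sum, map_smul, smul_eq_mul, intervalIntegral.integral_mul_const]
  rw [weakIntegral_eq_of_forall hpair, hpair]

theorem weakIntegral_add (hf : WeaklyContinuousOn f (Set.uIcc p q))
    (hg : WeaklyContinuousOn g (Set.uIcc p q)) :
    weakIntegral p q (fun s => f s + g s) = weakIntegral p q f + weakIntegral p q g :=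
  weakIntegral_eq_of_forall fun φ => by
    simp only [map_add, hf.dual_weakIntegral, hg.dual_weakIntegral]
    exact (intervalIntegral.integral_add (hf φ).intervalIntegrable (hg φ).intervalIntegrable).symm

theorem weakIntegral_smul (hf : WeaklyContinuousOn f (Set.uIcc p q)) (c : ℝ) :
    weakIntegral p q (fun s => c • f s) = c • weakIntegral p q f :=
  weakIntegral_eq_of_forall fun φ => by
    simp only [map_smul, hf.dual_weakIntegral, smul_eq_mul, intervalIntegral.integral_const_mul]

theorem weakIntegral_mem (hf : WeaklyContinuousOn f (Set.uIcc p q)) {S : Submodule ℝ V}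
    (h : ∀ t ∈ Set.uIcc p q, f t ∈ S) : weakIntegral p q f ∈ S := by
  by_contra hn
  obtain ⟨φ, hφ, hS⟩ := S.exists_le_ker_of_notMem hn
  refine hφ ?_
  rw [hf.dual_weakIntegral,
    intervalIntegral.integral_congr (g := fun _ => 0) fun s hs => hS (h s hs),
    intervalIntegral.integral_zero]

theorem hasWeakDerivOn_weakIntegral_left {a b : ℝ} (hf : WeaklyContinuousOn f (Set.Icc a b))
    (hq : q ∈ Set.Icc a b) :
    HasWeakDerivOn (fun p => weakIntegral p q f) (fun p => -f p) (Set.Icc a b) := by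
  intro φ t ht
  have : Fact (t ∈ Set.Icc a b) := ⟨ht⟩
  have hsub {p} (hp : p ∈ Set.Icc a b) : WeaklyContinuousOn f (Set.uIcc p q) :=
    hf.mono (Set.uIcc_subset_Icc hp hq)
  have hderiv : HasDerivWithinAt (fun p => ∫ s in p..q, φ (f s)) (-φ (f t)) (Set.Icc a b) t :=
    intervalIntegral.integral_hasDerivWithinAt_left (hsub ht φ).intervalIntegrable
      ((hf φ).stronglyMeasurableAtFilter_nhdsWithin measurableSet_Icc t) (hf φ t ht)
  rw [map_neg]
  exact hderiv.congr_of_mem (fun p hp => (hsub hp).dual_weakIntegral φ) ht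

end WeaklyContinuousOn

end WeakCalculus

/-! ### Multilinear functions of finite lists -/

section Linearity

variable {R : Type*} [Semiring R] {V W Z : Type*} [AddCommMonoid V] [Module R V]
  [AddCommMonoid W] [Module R W] [AddCommMonoid Z] [Module R Z]

theorem isLinearMap_zero : IsLinearMap R fun _ : V => (0 : W) := (0 : V →ₗ[R] W).isLinear

theorem isLinearMap_add {f g : V → W} (hf : IsLinearMap R f) (hg : IsLinearMap R g) :
    IsLinearMap R fun x => f x + g x := (hf.mk' + hg.mk').isLinear

theorem isLinearMap_sum {ι : Type*} {s : Finset ι} {f : ι → V → W}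
    (h : ∀ i ∈ s, IsLinearMap R (f i)) : IsLinearMap R fun x => ∑ i ∈ s, f i x where
  map_add x y := by
    rw [← Finset.sum_add_distrib]
    exact Finset.sum_congr rfl fun i hi => (h i hi).map_add x y
  map_smul c x := by
    rw [Finset.smul_sum]
    exact Finset.sum_congr rfl fun i hi => (h i hi).map_smul c x

variable (R) in
/-- Linearity in each entry of a function of finite lists of vectors. Such a function encodes a
family of multilinear maps, one for each length. -/
def IsListMultilinear (Φ : List V → W) : Prop :=
  ∀ l₁ l₂ : List V, IsLinearMap R fun x => Φ (l₁ ++ x :: l₂)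

namespace IsListMultilinear

variable {Φ Ψ : List V → W}

theorem cons (h : IsListMultilinear R Φ) (x : V) : IsListMultilinear R fun l => Φ (x :: l) :=
  fun l₁ l₂ => h (x :: l₁) l₂

theorem head (h : IsListMultilinear R Φ) (l : List V) : IsLinearMap R fun x => Φ (x :: l) :=
  h [] l

theorem head_comp (h : IsListMultilinear R Φ) {f : Z → V} (hf : IsLinearMap R f) (l : List V) :
    IsLinearMap R fun z => Φ (f z :: l) :=
  ((h.head l).mk' ∘ₗ hf.mk').isLinear

theorem sub {R V W : Type*} [Ring R] [AddCommMonoid V] [Module R V] [AddCommGroup W]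
    [Module R W] {Φ Ψ : List V → W} (h : IsListMultilinear R Φ) (h' : IsListMultilinear R Ψ) :
    IsListMultilinear R fun l => Φ l - Ψ l :=
  fun l₁ l₂ => ((h l₁ l₂).mk' - (h' l₁ l₂).mk').isLinear

theorem eq_zero_of_mem (h : IsListMultilinear R Φ) {l : List V} (hl : (0 : V) ∈ l) : Φ l = 0 := by
  obtain ⟨l₁, l₂, rfl⟩ := List.append_of_mem hl
  exact (h l₁ l₂).mk'.map_zero

end IsListMultilinear

end Linearity

section PrefixSum

variable {V W Z : Type*} [AddCommMonoid W] [AddCommMonoid Z]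

/-- The sum of `K v u` over all decompositions `l = v ++ u` with `v ≠ []`. -/
def prefixSum (K : List V → List V → W) (l : List V) : W :=
  ∑ i ∈ Finset.range l.length, K (l.take (i + 1)) (l.drop (i + 1))

theorem prefixSum_nil (K : List V → List V → W) : prefixSum K [] = 0 := rfl

theorem prefixSum_cons (K : List V → List V → W) (x : V) (w : List V) :
    prefixSum K (x :: w) = K [x] w + prefixSum (fun v u => K (x :: v) u) w := by
  rw [prefixSum, List.length_cons, Finset.sum_range_succ', add_comm]
  rfl

theorem take_succ_ne_nil {l : List V} {i : ℕ} (hi : i < l.length) : l.take (i + 1) ≠ [] := by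
  simpa only [ne_eq, List.take_eq_nil_iff, Nat.add_one_ne_zero, false_or] using
    List.ne_nil_of_length_pos (Nat.zero_lt_of_lt hi)

theorem prefixSum_congr {K K' : List V → List V → W} {l : List V}
    (h : ∀ v u, v ≠ [] → l = v ++ u → K v u = K' v u) : prefixSum K l = prefixSum K' l :=
  Finset.sum_congr rfl fun _ hi => h _ _
    (take_succ_ne_nil (Finset.mem_range.1 hi)) (List.take_append_drop _ _).symm

theorem prefixSum_eq_zero {K : List V → List V → W} {l : List V}
    (h : ∀ v u, v ≠ [] → l = v ++ u → K v u = 0) : prefixSum K l = 0 :=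
  (prefixSum_congr h).trans Finset.sum_const_zero

theorem prefixSum_add (K K' : List V → List V → W) (l : List V) :
    prefixSum (fun v u => K v u + K' v u) l = prefixSum K l + prefixSum K' l :=
  Finset.sum_add_distrib

theorem prefixSum_eq_head {K : List V → List V → W} {x : V} {w : List V}
    (h : ∀ v u, v ≠ [] → w = v ++ u → K (x :: v) u = 0) : prefixSum K (x :: w) = K [x] w := by
  rw [prefixSum_cons, prefixSum_eq_zero h, add_zero]

theorem prefixSum_eq_self {K : List V → List V → W} {l : List V} (hl : l ≠ [])
    (h : ∀ v u, u ≠ [] → l = v ++ u → K v u = 0) : prefixSum K l = K l [] := by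
  induction l generalizing K with
  | nil => exact absurd rfl hl
  | cons x w ih =>
    rw [prefixSum_cons]
    rcases eq_or_ne w [] with rfl | hw
    · rw [prefixSum_nil, add_zero]
    · rw [h [x] w hw rfl, zero_add,
        ih hw fun v u hu e => h (x :: v) u hu (congrArg (List.cons x) e)]

theorem prefixSum_append_cons (K : List V → List V → W) (l₁ : List V) (x : V) (l₂ : List V) :
    prefixSum K (l₁ ++ x :: l₂) = prefixSum (fun v u => K v (u ++ x :: l₂)) l₁ +
      (K (l₁ ++ [x]) l₂ + prefixSum (fun v u => K (l₁ ++ x :: v) u) l₂) := by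
  induction l₁ generalizing K with
  | nil => rw [List.nil_append, prefixSum_cons, prefixSum_nil, zero_add]; rfl
  | cons y l₁ ih =>
    rw [List.cons_append, prefixSum_cons, ih, prefixSum_cons, add_assoc]
    rfl

theorem prefixSum_assoc (T : List V → List V → List V → W) (l : List V) :
    prefixSum (fun v u => prefixSum (fun v₁ v₂ => T v₁ v₂ u) v) l =
      prefixSum (fun v u => T v [] u + prefixSum (T v) u) l := by
  induction l generalizing T with
  | nil => rfl
  | cons x w ih =>
    simp only [prefixSum_cons, prefixSum_nil, prefixSum_add, ih, add_zero, add_assoc]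

variable {R : Type*} [Semiring R] [Module R W] [Module R Z]

theorem isLinearMap_prefixSum {K : Z → List V → List V → W} {l : List V}
    (h : ∀ v u, v ≠ [] → l = v ++ u → IsLinearMap R fun z => K z v u) :
    IsLinearMap R fun z => prefixSum (K z) l :=
  isLinearMap_sum fun _ hi => h _ _ (take_succ_ne_nil (Finset.mem_range.1 hi))
    (List.take_append_drop _ _).symm

theorem IsListMultilinear.prefixSum {V : Type*} [AddCommMonoid V] [Module R V]
    {K : List V → List V → W} (hleft : ∀ u, IsListMultilinear R fun v => K v u)
    (hright : ∀ v, v ≠ [] → IsListMultilinear R (K v)) :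
    IsListMultilinear R (AInfFamily.prefixSum K) := by
  intro l₁ l₂
  simp only [prefixSum_append_cons]
  exact isLinearMap_add (isLinearMap_prefixSum fun _ u hv _ => hright _ hv u l₂)
    (isLinearMap_add (hleft l₂ l₁ []) (isLinearMap_prefixSum fun v u _ _ => hleft u l₁ v))

end PrefixSum

section InsertSum

variable {R : Type*} [Semiring R] {V W Z : Type*} [AddCommMonoid W] [AddCommMonoid Z]

/-- The sum of `Φ (g v :: u)` over all decompositions `l = v ++ u` with `v ≠ []`. -/
def headInsertSum (g : List V → V) (Φ : List V → W) : List V → W :=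
  prefixSum fun v u => Φ (g v :: u)

/-- The sum of `Φ (σ l₁ ++ g l₂ :: l₃)` over all decompositions `l = l₁ ++ l₂ ++ l₃` with
`l₂ ≠ []`, where `σ` is applied to all entries of `l₁`. It is the coderivation with corestriction
`g` of the bar construction, composed with `Φ`; the signs that `g` picks up when it moves past
`l₁` are contained in `σ`. -/
def insertSum (σ : V → V) (g : List V → V) (Φ : List V → W) (l : List V) : W :=
  ∑ j ∈ Finset.range l.length, headInsertSum g (fun u => Φ ((l.take j).map σ ++ u)) (l.drop j)

variable {σ τ : V → V} {g h : List V → V}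

theorem insertSum_nil (Φ : List V → W) : insertSum σ g Φ [] = 0 := rfl

theorem insertSum_cons (Φ : List V → W) (x : V) (w : List V) :
    insertSum σ g Φ (x :: w) =
      headInsertSum g Φ (x :: w) + insertSum σ g (fun l => Φ (σ x :: l)) w := by
  rw [insertSum, List.length_cons, Finset.sum_range_succ', add_comm]
  rfl

theorem insertSum_congr {Φ Φ' : List V → W} {l : List V}
    (h : ∀ l₁ l₂ l₃, l₂ ≠ [] → l = l₁ ++ (l₂ ++ l₃) →
      Φ (l₁.map σ ++ g l₂ :: l₃) = Φ' (l₁.map σ ++ g l₂ :: l₃)) :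
    insertSum σ g Φ l = insertSum σ g Φ' l :=
  Finset.sum_congr rfl fun j _ => prefixSum_congr fun v u hv hvu => h _ v u hv <| by
    rw [← hvu, List.take_append_drop]

theorem insertSum_zero (l : List V) : insertSum σ g (fun _ => (0 : W)) l = 0 :=
  Finset.sum_eq_zero fun _ _ => prefixSum_eq_zero fun _ _ _ _ => rfl

theorem insertSum_eq_zero {Φ : List V → W} {l : List V}
    (h : ∀ l₁ l₂ l₃, l₂ ≠ [] → l = l₁ ++ (l₂ ++ l₃) → Φ (l₁.map σ ++ g l₂ :: l₃) = 0) :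
    insertSum σ g Φ l = 0 :=
  (insertSum_congr h).trans (insertSum_zero l)

theorem insertSum_add (Φ Φ' : List V → W) (l : List V) :
    insertSum σ g (fun l => Φ l + Φ' l) l = insertSum σ g Φ l + insertSum σ g Φ' l := by
  simp only [insertSum, headInsertSum, prefixSum_add, Finset.sum_add_distrib]

theorem insertSum_sub {W : Type*} [AddCommGroup W] (Φ Φ' : List V → W) (l : List V) :
    insertSum σ g (fun l => Φ l - Φ' l) l = insertSum σ g Φ l - insertSum σ g Φ' l := by
  simp only [insertSum, headInsertSum, prefixSum, Finset.sum_sub_distrib]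

theorem insertSum_sub_left {R : Type*} [Ring R] {V W : Type*} [AddCommGroup V] [Module R V]
    [AddCommGroup W] [Module R W] {σ : V → V} {g h : List V → V} {Φ : List V → W}
    (hΦ : IsListMultilinear R Φ) (l : List V) :
    insertSum σ (fun l => g l - h l) Φ l = insertSum σ g Φ l - insertSum σ h Φ l := by
  simp only [insertSum, headInsertSum, prefixSum, (hΦ _ _).map_sub, Finset.sum_sub_distrib]

theorem map_insertSum (f : W →+ Z) (Φ : List V → W) (l : List V) :
    f (insertSum σ g Φ l) = insertSum σ g (fun l => f (Φ l)) l := by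
  simp only [insertSum, headInsertSum, prefixSum, map_sum]

theorem isLinearMap_insertSum [Module R W] [Module R Z] {Φ : Z → List V → W}
    (hΦ : ∀ l, IsLinearMap R fun z => Φ z l) (l : List V) :
    IsLinearMap R fun z => insertSum σ g (Φ z) l :=
  isLinearMap_sum fun _ _ => isLinearMap_prefixSum fun _ _ _ _ => hΦ _

theorem IsListMultilinear.headInsertSum [AddCommMonoid V] [Module R V] [Module R W]
    (hg : IsListMultilinear R g) {Φ : List V → W} (hΦ : IsListMultilinear R Φ) :
    IsListMultilinear R (AInfFamily.headInsertSum g Φ) :=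
  .prefixSum (fun u l₁ l₂ => hΦ.head_comp (hg l₁ l₂) u) fun v _ => hΦ.cons (g v)

theorem IsListMultilinear.insertSum [AddCommMonoid V] [Module R V] [Module R W]
    (hσ : IsLinearMap R σ) (hg : IsListMultilinear R g) {Φ : List V → W}
    (hΦ : IsListMultilinear R Φ) : IsListMultilinear R (AInfFamily.insertSum σ g Φ) := by
  intro l₁ l₂
  induction l₁ generalizing Φ with
  | nil =>
    simp only [List.nil_append, insertSum_cons]
    exact isLinearMap_add (hg.headInsertSum hΦ [] l₂)
      (isLinearMap_insertSum (fun l => hΦ.head_comp hσ l) l₂)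
  | cons y l₁ ih =>
    simp only [List.cons_append, insertSum_cons]
    exact isLinearMap_add (hg.headInsertSum hΦ (y :: l₁) l₂) (ih (hΦ.cons (σ y)))

/-- The co-Leibniz rule of the coderivation `insertSum σ g` with respect to deconcatenation. -/
theorem insertSum_prefixSum (K : List V → List V → W) (l : List V) :
    insertSum σ g (prefixSum K) l =
      prefixSum (fun v u =>
        insertSum σ g (fun v => K v u) v + insertSum σ g (K (v.map σ)) u) l := by
  induction l generalizing K with
  | nil => rfl
  | cons x w ih =>
    have hassoc := prefixSum_assoc (fun v v' u => K (g v :: v') u) (x :: w)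
    simp only [insertSum_cons, insertSum_nil, insertSum_add, ih, headInsertSum, prefixSum_add,
      prefixSum_cons, prefixSum_nil, List.map_cons, List.map_nil, add_zero] at hassoc ⊢
    rw [← add_assoc, ← hassoc]
    abel

theorem insertSum_headInsertSum [AddCommMonoid V] [Module R V] [Module R W] {Φ : List V → W}
    (hΦ : IsListMultilinear R Φ) (l : List V) :
    insertSum σ g (headInsertSum h Φ) l = headInsertSum (insertSum σ g h) Φ l +
      prefixSum (fun v u => insertSum σ g (fun l => Φ (h (v.map σ) :: l)) u) l := by
  rw [headInsertSum, insertSum_prefixSum, prefixSum_add]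
  refine congrArg (· + _) (prefixSum_congr fun v u _ _ => ?_)
  exact (map_insertSum (hΦ.head u).mk'.toAddMonoidHom h v).symm

theorem insertSum_insertSum_cons (Φ : List V → W) (x : V) (w : List V) :
    insertSum σ g (insertSum τ h Φ) (x :: w) = insertSum σ g (headInsertSum h Φ) (x :: w) +
      prefixSum (fun v u => insertSum τ h (fun l => Φ (τ (g v) :: l)) u) (x :: w) +
      insertSum σ g (insertSum τ h fun l => Φ (τ (σ x) :: l)) w := by
  simp only [insertSum_cons (σ := σ), insertSum_cons (σ := τ), insertSum_add, headInsertSum,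
    prefixSum_add]
  abel

/-- The commutator of two coderivations is again a coderivation. Both sides are moved so that no
subtraction occurs; `g` has reduced degree `0`, hence the sign operator `id`. -/
theorem insertSum_insertSum_comm [AddCommMonoid V] [Module R V] [Module R W] {Φ : List V → W}
    (hg : ∀ l, g (l.map σ) = σ (g l)) (hΦ : IsListMultilinear R Φ) (l : List V) :
    insertSum σ h (insertSum id g Φ) l + insertSum σ (insertSum id g h) Φ l =
      insertSum id g (insertSum σ h Φ) l + insertSum σ (insertSum σ h g) Φ l := by
  induction l generalizing Φ with
  | nil => rfl
  | cons x w ih =>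
    have hw := ih (hΦ.cons (σ x))
    simp only [insertSum_insertSum_cons, insertSum_headInsertSum hΦ, insertSum_cons (σ := σ) Φ, hg,
      id, List.map_id]
    grind

end InsertSum

section Single

variable {R : Type*} [Semiring R] {V : Type*} [AddCommMonoid V] [Module R V]

/-- The identity on one-element lists, extended by zero to all other lists. -/
def single : List V → V
  | [x] => x
  | _ => 0

theorem single_of_length_ne {l : List V} (h : l.length ≠ 1) : single l = 0 := by
  match l with
  | [] => rfl
  | [_] => exact absurd rfl h
  | _ :: _ :: _ => rfl

theorem isListMultilinear_single : IsListMultilinear R (single : List V → V) := by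
  intro l₁ l₂
  by_cases h : l₁ = [] ∧ l₂ = []
  · obtain ⟨rfl, rfl⟩ := h
    exact LinearMap.id.isLinear
  · have hzero (x : V) : single (l₁ ++ x :: l₂) = 0 := single_of_length_ne fun hl => h <| by
      simp only [List.length_append, List.length_cons] at hl
      exact ⟨List.length_eq_zero_iff.1 (by omega), List.length_eq_zero_iff.1 (by omega)⟩
    simpa only [hzero] using isLinearMap_zero

theorem insertSum_single {σ : V → V} {g : List V → V} {l : List V} (hl : l ≠ []) :
    insertSum σ g single l = g l := by
  obtain ⟨x, w, rfl⟩ := List.exists_cons_of_ne_nil hl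
  have hhead : headInsertSum g single (x :: w) = g (x :: w) :=
    prefixSum_eq_self hl fun v u hu _ => single_of_length_ne <| by
      simpa only [List.length_cons, ne_eq, Nat.add_eq_right, List.length_eq_zero_iff] using hu
  have htail : insertSum σ g (fun l => single (σ x :: l)) w = 0 :=
    insertSum_eq_zero fun l₁ l₂ l₃ _ _ => single_of_length_ne <| by
      simp only [List.length_cons, List.length_append]
      omega
  rw [insertSum_cons, hhead, htail, add_zero]

end Single

theorem suffix_induction {V : Type*} {P : List V → Prop}
    (step : ∀ l, (∀ v u, v ≠ [] → l = v ++ u → P u) → P l) (l : List V) : P l :=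
  (measure List.length).wf.induction l fun l ih => step l fun v u hv hvu => ih u <| by
    change u.length < l.length
    have := List.length_pos_iff.2 hv
    rw [hvu, List.length_append]
    omega

section BlockSum

theorem sum_composition_succ {W : Type*} [AddCommMonoid W] (n : ℕ) (f : List ℕ → W) :
    ∑ c : Composition (n + 1), f c.blocks =
      ∑ i ∈ Finset.range (n + 1), ∑ c : Composition (n - i), f ((i + 1) :: c.blocks) := by
  let consBlock (x : Σ i : Fin (n + 1), Composition (n - i)) : Composition (n + 1) :=
    ⟨(x.1 + 1) :: x.2.blocks, by simpa using fun _ h => x.2.blocks_pos h, by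
      rw [List.sum_cons, x.2.blocks_sum]
      omega⟩
  have hbij : consBlock.Bijective := by
    refine ⟨?_, ?_⟩
    · rintro ⟨i, c⟩ ⟨i', c'⟩ h
      simp only [consBlock, Composition.mk.injEq, List.cons.injEq, add_left_inj, Fin.val_inj] at h
      obtain ⟨rfl, h⟩ := h
      rw [Composition.ext h]
    · rintro ⟨_ | ⟨k, b⟩, hpos, hsum⟩
      · simp at hsum
      · have hk := hpos List.mem_cons_self
        rw [List.sum_cons] at hsum
        refine ⟨⟨⟨k - 1, by omega⟩, b, fun h => hpos (List.mem_cons_of_mem k h), ?_⟩, ?_⟩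
        · simp only
          omega
        · exact Composition.ext (congrArg (· :: b) (Nat.sub_add_cancel hk))
  rw [Finset.sum_range, ← Fintype.sum_sigma
    fun x : Σ i : Fin (n + 1), Composition (n - i) => f ((x.1 + 1) :: x.2.blocks)]
  exact (Fintype.sum_bijective consBlock hbij _ _ fun _ => rfl).symm

variable {R : Type*} [Semiring R] {V Z W : Type*} [AddCommMonoid W]

/-- The sum of `Ψ [F b₁, …, F b_r]` over all decompositions of a list into nonempty blocks
`b₁, …, b_r`: the morphism of bar constructions with corestriction `F`, composed with `Ψ`. -/
def blockSum (F : List V → Z) (Ψ : List Z → W) (l : List V) : W :=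
  ∑ c : Composition l.length, Ψ ((l.splitWrtComposition c).map F)

variable {F : List V → Z}

theorem blockSum_eq_sum_blocks {Ψ : List Z → W} {l : List V} {n : ℕ} (h : l.length = n) :
    blockSum F Ψ l = ∑ c : Composition n, Ψ ((l.splitWrtCompositionAux c.blocks).map F) := by
  subst h
  rfl

theorem blockSum_nil (Ψ : List Z → W) : blockSum F Ψ [] = Ψ [] := by
  have hblocks (c : Composition 0) : c.blocks = [] := c.blocks_eq_nil.2 rfl
  rw [blockSum_eq_sum_blocks List.length_nil]
  simp only [hblocks, List.splitWrtCompositionAux, List.map_nil, Finset.sum_const, Finset.card_univ,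
    composition_card, Nat.zero_sub, pow_zero, one_smul]

theorem blockSum_eq_prefixSum {Ψ : List Z → W} {l : List V} (hl : l ≠ []) :
    blockSum F Ψ l = prefixSum (fun v u => blockSum F (fun m => Ψ (F v :: m)) u) l := by
  obtain ⟨x, w, rfl⟩ := List.exists_cons_of_ne_nil hl
  rw [blockSum_eq_sum_blocks (List.length_cons ..), sum_composition_succ w.length
    fun b => Ψ (((x :: w).splitWrtCompositionAux b).map F)]
  refine Finset.sum_congr rfl fun i _ => ?_
  simp only [List.splitWrtCompositionAux_cons, List.map_cons]
  rw [List.drop_succ_cons, blockSum_eq_sum_blocks List.length_drop]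

variable [AddCommMonoid Z] [Module R Z] [Module R W] {Ψ : List Z → W}

theorem IsListMultilinear.blockSum_head (hΨ : IsListMultilinear R Ψ) (l : List V) :
    IsLinearMap R fun z => blockSum F (fun m => Ψ (z :: m)) l :=
  isLinearMap_sum fun _ _ => hΨ.head _

theorem IsListMultilinear.blockSum [AddCommMonoid V] [Module R V] (hF : IsListMultilinear R F)
    (hΨ : IsListMultilinear R Ψ) : IsListMultilinear R (AInfFamily.blockSum F Ψ) := by
  intro l₁ l₂
  induction l₁ using suffix_induction generalizing Ψ with
  | step l₁ ih =>
    have hne (x : V) : l₁ ++ x :: l₂ ≠ [] := List.append_ne_nil_of_right_ne_nil _ (by simp)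
    have hhead (f : V → Z) (hf : IsLinearMap R f) (u : List V) :
        IsLinearMap R fun x => AInfFamily.blockSum F (fun m => Ψ (f x :: m)) u :=
      ((hΨ.blockSum_head u).mk' ∘ₗ hf.mk').isLinear
    simp only [blockSum_eq_prefixSum (hne _), prefixSum_append_cons]
    exact isLinearMap_add (isLinearMap_prefixSum fun v u hv hvu => ih v u hv hvu (hΨ.cons _))
      (isLinearMap_add (hhead _ (hF l₁ []) l₂)
        (isLinearMap_prefixSum fun v u _ _ => hhead _ (hF l₁ v) u))

theorem blockSum_single [AddCommMonoid V] [Module R V] {Ψ : List V → W}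
    (hΨ : IsListMultilinear R Ψ) (l : List V) : blockSum single Ψ l = Ψ l := by
  induction l generalizing Ψ with
  | nil => exact blockSum_nil Ψ
  | cons x w ih =>
    rw [blockSum_eq_prefixSum (List.cons_ne_nil x w), prefixSum_eq_head, ih (hΨ.cons _)]
    · rfl
    · intro v u hv _
      rw [single_of_length_ne (by simpa using hv)]
      exact (hΨ.blockSum_head u).mk'.map_zero

theorem insertSum_blockSum {A : List V → V} (hΨ : IsListMultilinear R Ψ) (l : List V) :
    insertSum id A (blockSum F Ψ) l = prefixSum (fun v u =>
      blockSum F (fun m => Ψ (insertSum id A F v :: m)) u +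
        insertSum id A (blockSum F fun m => Ψ (F v :: m)) u) l := by
  have hblock : insertSum id A (blockSum F Ψ) l =
      insertSum id A (prefixSum fun v u => blockSum F (fun m => Ψ (F v :: m)) u) l :=
    insertSum_congr fun _ _ _ _ _ => blockSum_eq_prefixSum (by simp)
  rw [hblock, insertSum_prefixSum]
  refine prefixSum_congr fun v u _ _ => ?_
  rw [List.map_id]
  exact congrArg (· + _) (map_insertSum (hΨ.blockSum_head u).mk'.toAddMonoidHom F v).symm

end BlockSum

/-! ### Tree integrals and transport -/

section WeakCalculusOfSums

variable {V : Type*} [AddCommGroup V] [Module ℝ V] {W : Type*} [AddCommGroup W] [Module ℝ W]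
  {Z : Type*} [AddCommGroup Z] [Module ℝ Z] {σ : V → V}

theorem WeaklyContinuousOn.insertSum {X : Type*} [TopologicalSpace X] {s : Set X}
    (hs : IsCompact s) {g : X → List V → V} {Φ : X → List V → W}
    (hΦ : ∀ t ∈ s, IsListMultilinear ℝ (Φ t)) (hg : ∀ l, WeaklyContinuousOn (fun t => g t l) s)
    (h : ∀ l, WeaklyContinuousOn (fun t => Φ t l) s) (l : List V) :
    WeaklyContinuousOn (fun t => insertSum σ (g t) (Φ t) l) s := by
  simp only [AInfFamily.insertSum, headInsertSum, prefixSum]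
  exact .sum fun _ _ => .sum fun _ _ => .apply hs (B := fun t x => Φ t (_ ++ x :: _))
    (fun t ht => hΦ t ht _ _) (fun _ => h _) (hg _)

namespace HasWeakDerivOn

variable {s : Set ℝ}

theorem prefixSum {U : Type*} {K K' : ℝ → List U → List U → W} {l : List U}
    (h : ∀ v u, v ≠ [] → l = v ++ u → HasWeakDerivOn (fun t => K t v u) (fun t => K' t v u) s) :
    HasWeakDerivOn (fun t => prefixSum (K t) l) (fun t => prefixSum (K' t) l) s :=
  .sum fun _ hi => h _ _ (take_succ_ne_nil (Finset.mem_range.1 hi)) (List.take_append_drop _ _).symm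

theorem insertSum (hs : IsCompact s) {g g' : ℝ → List V → V} {Φ Φ' : ℝ → List V → W}
    (hΦ : ∀ t ∈ s, IsListMultilinear ℝ (Φ t)) (hΦ' : ∀ t ∈ s, IsListMultilinear ℝ (Φ' t))
    (hg : ∀ l, HasWeakDerivOn (fun t => g t l) (fun t => g' t l) s)
    (h : ∀ l, HasWeakDerivOn (fun t => Φ t l) (fun t => Φ' t l) s) (l : List V) :
    HasWeakDerivOn (fun t => insertSum σ (g t) (Φ t) l)
      (fun t => insertSum σ (g t) (Φ' t) l + insertSum σ (g' t) (Φ t) l) s := by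
  simp only [AInfFamily.insertSum, headInsertSum, AInfFamily.prefixSum, ← Finset.sum_add_distrib]
  exact .sum fun _ _ => .sum fun _ _ => .apply hs (B := fun t x => Φ t (_ ++ x :: _))
    (fun t ht => hΦ t ht _ _) (fun t ht => hΦ' t ht _ _) (fun _ => h _) (hg _)

theorem blockSum {U : Type*} (hs : IsCompact s) {A : ℝ → List U → U} {F : ℝ → List U → Z}
    {Ψ : List Z → W} (hΨ : IsListMultilinear ℝ Ψ)
    (hF : ∀ l, HasWeakDerivOn (fun t => F t l) (fun t => AInfFamily.insertSum id (A t) (F t) l) s)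
    (l : List U) :
    HasWeakDerivOn (fun t => blockSum (F t) Ψ l)
      (fun t => AInfFamily.insertSum id (A t) (blockSum (F t) Ψ) l) s := by
  induction l using suffix_induction generalizing Ψ with
  | step l ih =>
    by_cases hl : l = []
    · subst hl
      simpa only [blockSum_nil, insertSum_nil] using const (Ψ [])
    · simp only [blockSum_eq_prefixSum hl, insertSum_blockSum hΨ]
      refine prefixSum fun v u hv hvu => ?_
      refine (apply hs (fun t _ => hΨ.blockSum_head u)
        (fun t _ => isLinearMap_insertSum (fun l => hΨ.blockSum_head l) u)
        (fun z => ih v u hv hvu (hΨ.cons z)) (hF v)).congr (fun _ _ => rfl) fun _ _ => add_comm _ _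

end HasWeakDerivOn

theorem isLinearMap_weakIntegral {p q : ℝ} {K : Z → ℝ → V}
    (h : ∀ s ∈ Set.uIcc p q, IsLinearMap ℝ fun z => K z s)
    (hK : ∀ z, WeaklyContinuousOn (K z) (Set.uIcc p q)) :
    IsLinearMap ℝ fun z => weakIntegral p q (K z) where
  map_add x y := by
    rw [← (hK x).weakIntegral_add (hK y)]
    exact weakIntegral_congr fun s hs => (h s hs).map_add x y
  map_smul c x := by
    rw [← (hK x).weakIntegral_smul c]
    exact weakIntegral_congr fun s hs => (h s hs).map_smul c x

end WeakCalculusOfSums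

section Transport

variable {V : Type*} [AddCommGroup V] [Module ℝ V]

/-- The integral over the simplex between `p` and `q` of the sum of all trees with `k` levels whose
vertices are decorated by `A`, the level next to the leaves being integrated last. -/
def treeIntegral (A : ℝ → List V → V) (q : ℝ) : ℕ → ℝ → List V → V
  | 0, _, l => single l
  | k + 1, p, l => weakIntegral p q fun s => insertSum id (A s) (treeIntegral A q k s) l

/-- The alternating sum over `k` of the tree integrals with `k` levels. On a list of length `n` only
the integrals with fewer than `n` levels contribute. -/
def treeTransport (A : ℝ → List V → V) (q p : ℝ) (l : List V) : V :=
  ∑ k ∈ Finset.range l.length, (-1 : ℝ) ^ k • treeIntegral A q k p l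

/-- A family of multilinear operations without unary component, depending weakly continuously on a
parameter in `s`: the restriction of the form components `α^{1,r}` to a path. -/
structure IsConnection (A : ℝ → List V → V) (s : Set ℝ) : Prop where
  isListMultilinear : ∀ t ∈ s, IsListMultilinear ℝ (A t)
  weaklyContinuousOn : ∀ l, WeaklyContinuousOn (fun t => A t l) s
  unary_eq_zero : ∀ t ∈ s, ∀ x, A t [x] = 0

variable {A : ℝ → List V → V} {a b p q : ℝ}

theorem IsConnection.insertSum_eq_zero {s : Set ℝ} (hA : IsConnection A s) {t : ℝ} (ht : t ∈ s)
    {Φ : List V → V} {l : List V} (h0 : ∀ l', 0 ∈ l' → Φ l' = 0)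
    (h : ∀ l', l' ≠ [] → l'.length < l.length → Φ l' = 0) : insertSum id (A t) Φ l = 0 := by
  refine AInfFamily.insertSum_eq_zero fun l₁ l₂ l₃ hl₂ hl => ?_
  match l₂ with
  | [] => exact absurd rfl hl₂
  | [x] =>
    rw [hA.unary_eq_zero t ht]
    exact h0 _ (List.mem_append_right _ List.mem_cons_self)
  | _ :: _ :: _ =>
    refine h _ (List.append_ne_nil_of_right_ne_nil _ (List.cons_ne_nil _ _)) ?_
    simp only [hl, List.map_id, List.length_append, List.length_cons]
    omega

theorem treeIntegral_isListMultilinear_and_weaklyContinuousOn (hA : IsConnection A (Set.Icc a b))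
    (hq : q ∈ Set.Icc a b) (k : ℕ) :
    (∀ p ∈ Set.Icc a b, IsListMultilinear ℝ (treeIntegral A q k p)) ∧
      ∀ l, WeaklyContinuousOn (fun p => treeIntegral A q k p l) (Set.Icc a b) := by
  induction k with
  | zero => exact ⟨fun _ _ => isListMultilinear_single, fun l => .const (single l)⟩
  | succ k ih =>
    have hcont := WeaklyContinuousOn.insertSum (σ := id) isCompact_Icc ih.1 hA.weaklyContinuousOn
      ih.2
    refine ⟨fun p hp l₁ l₂ => ?_, fun l =>
      ((hcont l).hasWeakDerivOn_weakIntegral_left hq).weaklyContinuousOn⟩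
    have hpq := Set.uIcc_subset_Icc hp hq
    exact isLinearMap_weakIntegral
      (fun s hs => (hA.isListMultilinear s (hpq hs)).insertSum LinearMap.id.isLinear
        (ih.1 s (hpq hs)) l₁ l₂) fun _ => (hcont _).mono hpq

theorem isListMultilinear_treeIntegral (hA : IsConnection A (Set.Icc a b)) (hp : p ∈ Set.Icc a b)
    (hq : q ∈ Set.Icc a b) (k : ℕ) : IsListMultilinear ℝ (treeIntegral A q k p) :=
  (treeIntegral_isListMultilinear_and_weaklyContinuousOn hA hq k).1 p hp

theorem weaklyContinuousOn_insertSum_treeIntegral (hA : IsConnection A (Set.Icc a b))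
    (hq : q ∈ Set.Icc a b) (k : ℕ) (l : List V) :
    WeaklyContinuousOn (fun p => insertSum id (A p) (treeIntegral A q k p) l) (Set.Icc a b) :=
  have htree := treeIntegral_isListMultilinear_and_weaklyContinuousOn hA hq k
  .insertSum isCompact_Icc htree.1 hA.weaklyContinuousOn htree.2 l

theorem hasWeakDerivOn_treeIntegral_succ (hA : IsConnection A (Set.Icc a b))
    (hq : q ∈ Set.Icc a b) (k : ℕ) (l : List V) :
    HasWeakDerivOn (fun p => treeIntegral A q (k + 1) p l)
      (fun p => -insertSum id (A p) (treeIntegral A q k p) l) (Set.Icc a b) :=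
  (weaklyContinuousOn_insertSum_treeIntegral hA hq k l).hasWeakDerivOn_weakIntegral_left hq

theorem treeIntegral_eq_zero (hA : IsConnection A (Set.Icc a b)) (hp : p ∈ Set.Icc a b)
    (hq : q ∈ Set.Icc a b) {k : ℕ} {l : List V} (hl : l.length ≤ k) :
    treeIntegral A q k p l = 0 := by
  induction k generalizing p l with
  | zero => exact single_of_length_ne (by omega)
  | succ k ih =>
    have hzero : Set.EqOn (fun s => insertSum id (A s) (treeIntegral A q k s) l) (fun _ => 0)
        (Set.uIcc p q) := fun s hs =>
      have hs := Set.uIcc_subset_Icc hp hq hs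
      hA.insertSum_eq_zero hs (fun _ => (isListMultilinear_treeIntegral hA hs hq k).eq_zero_of_mem)
        fun l' _ hl' => ih hs (Nat.le_of_lt_succ (hl'.trans_le hl))
    rw [treeIntegral, weakIntegral_congr hzero]
    exact weakIntegral_eq_of_forall fun φ => by
      simp only [map_zero, intervalIntegral.integral_zero]

theorem treeTransport_eq_sum (hA : IsConnection A (Set.Icc a b)) (hp : p ∈ Set.Icc a b)
    (hq : q ∈ Set.Icc a b) {N : ℕ} {l : List V} (hl : l.length ≤ N) :
    treeTransport A q p l = ∑ k ∈ Finset.range N, (-1 : ℝ) ^ k • treeIntegral A q k p l :=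
  Finset.sum_subset (Finset.range_mono hl) fun k _ hk => by
    rw [treeIntegral_eq_zero hA hp hq (by simpa using hk), smul_zero]

theorem isListMultilinear_treeTransport (hA : IsConnection A (Set.Icc a b)) (hp : p ∈ Set.Icc a b)
    (hq : q ∈ Set.Icc a b) : IsListMultilinear ℝ (treeTransport A q p) := by
  intro l₁ l₂
  simp only [treeTransport, List.length_append, List.length_cons]
  exact isLinearMap_sum fun k _ =>
    ((-1 : ℝ) ^ k • (isListMultilinear_treeIntegral hA hp hq k l₁ l₂).mk').isLinear

theorem treeTransport_self (l : List V) : treeTransport A q q l = single l := by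
  rcases l with - | ⟨x, w⟩
  · rfl
  · rw [treeTransport, List.length_cons, Finset.sum_range_succ']
    simp only [treeIntegral, weakIntegral_self, smul_zero, Finset.sum_const_zero, pow_zero,
      one_smul, zero_add]

theorem insertSum_treeTransport (hA : IsConnection A (Set.Icc a b)) (hp : p ∈ Set.Icc a b)
    (hq : q ∈ Set.Icc a b) (l : List V) :
    insertSum id (A p) (treeTransport A q p) l = ∑ k ∈ Finset.range l.length,
      (-1 : ℝ) ^ k • insertSum id (A p) (treeIntegral A q k p) l := by
  let insert : (List V → V) →ₗ[ℝ] V := (isLinearMap_insertSum (σ := id) (g := A p)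
    (Φ := fun Φ : List V → V => Φ) (fun l => (LinearMap.proj l).isLinear) l).mk'
  have hstable : insertSum id (A p) (treeTransport A q p) l =
      insert (∑ k ∈ Finset.range l.length, (-1 : ℝ) ^ k • treeIntegral A q k p) :=
    insertSum_congr fun l₁ l₂ l₃ hl₂ hl => by
      rw [treeTransport_eq_sum hA hp hq (N := l.length), Finset.sum_apply]
      · rfl
      · have := List.length_pos_iff.2 hl₂
        simp only [hl, List.map_id, List.length_append, List.length_cons]
        omega
  rw [hstable, map_sum]
  exact Finset.sum_congr rfl fun k _ => map_smul insert _ _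

theorem hasWeakDerivOn_treeTransport (hA : IsConnection A (Set.Icc a b)) (hq : q ∈ Set.Icc a b)
    (l : List V) :
    HasWeakDerivOn (fun p => treeTransport A q p l)
      (fun p => insertSum id (A p) (treeTransport A q p) l) (Set.Icc a b) := by
  have hsum := (HasWeakDerivOn.const (single l)).add <| .sum (u := Finset.range l.length)
    fun k _ => (hasWeakDerivOn_treeIntegral_succ hA hq k l).map
      ((-1 : ℝ) ^ (k + 1) • LinearMap.id)
  refine hsum.congr (fun p hp => ?_) fun p hp => ?_
  · rw [treeTransport_eq_sum hA hp hq (Nat.le_succ _), Finset.sum_range_succ', add_comm, pow_zero,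
      one_smul]
    rfl
  · rw [insertSum_treeTransport hA hp hq]
    refine .trans ?_ (zero_add _).symm
    exact Finset.sum_congr rfl fun k _ => by
      simp only [pow_succ, mul_neg_one, neg_smul, smul_neg, neg_neg, LinearMap.neg_apply,
        LinearMap.smul_apply, LinearMap.id_apply]

/-- The failure of the transport from time `t` to time `q` to intertwine the operations `μ t` and
`μ q`; the operator `ε` contains the signs that `μ t` picks up when it moves past inputs. -/
def transportDefect (A μ : ℝ → List V → V) (ε : V → V) (q t : ℝ) (l : List V) : V :=
  blockSum (treeTransport A q t) (μ q) l - insertSum ε (μ t) (treeTransport A q t) l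

section TransportDefect

variable {ε : V → V} {μ : ℝ → List V → V}

theorem isListMultilinear_transportDefect (hA : IsConnection A (Set.Icc a b))
    (hε : IsLinearMap ℝ ε) (hμ : ∀ t ∈ Set.Icc a b, IsListMultilinear ℝ (μ t))
    (hp : p ∈ Set.Icc a b) (hq : q ∈ Set.Icc a b) :
    IsListMultilinear ℝ (transportDefect A μ ε q p) := fun l₁ l₂ =>
  have hF := isListMultilinear_treeTransport hA hp hq
  ((hF.blockSum (hμ q hq) l₁ l₂).mk' _ - ((hμ p hp).insertSum hε hF l₁ l₂).mk' _).isLinear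

theorem transportDefect_self (hμ : IsListMultilinear ℝ (μ q)) {l : List V} (hl : l ≠ []) :
    transportDefect A μ ε q q l = 0 := by
  have hend : treeTransport A q q = single := funext treeTransport_self
  rw [transportDefect, hend, blockSum_single hμ, insertSum_single hl, sub_self]

theorem hasWeakDerivOn_transportDefect (hA : IsConnection A (Set.Icc a b))
    (hAε : ∀ t ∈ Set.Icc a b, ∀ l, A t (l.map ε) = ε (A t l))
    (hμ : IsListMultilinear ℝ (μ q))
    (hderiv : ∀ l, HasWeakDerivOn (fun t => μ t l)
      (fun t => insertSum id (A t) (μ t) l - insertSum ε (μ t) (A t) l) (Set.Icc a b))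
    (hq : q ∈ Set.Icc a b) (l : List V) :
    HasWeakDerivOn (fun t => transportDefect A μ ε q t l)
      (fun t => insertSum id (A t) (transportDefect A μ ε q t) l) (Set.Icc a b) := by
  have hF (t : ℝ) (ht : t ∈ Set.Icc a b) := isListMultilinear_treeTransport hA ht hq
  have hF_deriv := hasWeakDerivOn_treeTransport hA hq
  refine ((HasWeakDerivOn.blockSum isCompact_Icc hμ hF_deriv l).sub
    (.insertSum isCompact_Icc hF (fun t ht => (hA.isListMultilinear t ht).insertSum
      LinearMap.id.isLinear (hF t ht)) hderiv hF_deriv l)).congr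
    (fun _ _ => rfl) fun t ht => ?_
  have hcomm := insertSum_insertSum_comm (h := μ t) (hAε t ht) (hF t ht) l
  have hsub : insertSum id (A t) (transportDefect A μ ε q t) l =
      insertSum id (A t) (blockSum (treeTransport A q t) (μ q)) l -
        insertSum id (A t) (insertSum ε (μ t) (treeTransport A q t)) l := insertSum_sub _ _ l
  simp only [hsub, insertSum_sub_left (hF t ht), LinearMap.id_coe]
  rw [eq_sub_of_add_eq hcomm]
  abel

theorem transportDefect_eq_zero (hA : IsConnection A (Set.Icc a b))
    (hε : IsLinearMap ℝ ε) (hAε : ∀ t ∈ Set.Icc a b, ∀ l, A t (l.map ε) = ε (A t l))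
    (hμ : ∀ t ∈ Set.Icc a b, IsListMultilinear ℝ (μ t))
    (hderiv : ∀ l, HasWeakDerivOn (fun t => μ t l)
      (fun t => insertSum id (A t) (μ t) l - insertSum ε (μ t) (A t) l) (Set.Icc a b))
    (hp : p ∈ Set.Icc a b) (hq : q ∈ Set.Icc a b) {l : List V} (hl : l ≠ []) :
    transportDefect A μ ε q p l = 0 := by
  induction hn : l.length using Nat.strong_induction_on generalizing p l with
  | _ n ih =>
    subst hn
    have hinsert (t) (ht : t ∈ Set.Icc a b) :
        insertSum id (A t) (transportDefect A μ ε q t) l = 0 :=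
      hA.insertSum_eq_zero ht
        (fun _ => (isListMultilinear_transportDefect hA hε hμ ht hq).eq_zero_of_mem)
        fun l' hl' hlt => ih _ hlt ht hl' rfl
    have hconst := hasWeakDerivOn_transportDefect hA hAε (hμ q hq) hderiv hq l
    rw [hconst.eq_of_deriv_eq_zero (convex_Icc a b) hinsert hp hq,
      transportDefect_self (hμ q hq) hl]

end TransportDefect

end Transport

/-! ### Families of multilinear maps as functions of lists -/

section MultilinearFamilies

variable {R : Type*} [Semiring R] {V W Z : Type*} [AddCommMonoid V] [Module R V]
  [AddCommMonoid W] [Module R W] [AddCommMonoid Z] [Module R Z]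

/-- The function of finite lists given by a family of multilinear maps, one for each length. -/
def listEval (f : ∀ n, MultilinearMap R (fun _ : Fin n => V) W) (l : List V) : W := f l.length l.get

theorem listEval_eq (f : ∀ n, MultilinearMap R (fun _ : Fin n => V) W) {l : List V} {n : ℕ}
    (h : l.length = n) {b : Fin n → V} (hb : ∀ i (hi : i < l.length), l[i] = b ⟨i, h ▸ hi⟩) :
    listEval f l = f n b := by
  subst h
  exact congrArg _ (funext fun i : Fin l.length => hb i i.2)

theorem isListMultilinear_listEval (f : ∀ n, MultilinearMap R (fun _ : Fin n => V) W) :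
    IsListMultilinear R (listEval f) := by
  intro l₁ l₂
  have hlt : l₁.length < (l₁ ++ 0 :: l₂).length := by
    rw [List.length_append, List.length_cons]
    omega
  have hupdate (x : V) : listEval f (l₁ ++ x :: l₂) =
      f (l₁ ++ 0 :: l₂).length (Function.update (l₁ ++ 0 :: l₂).get ⟨l₁.length, hlt⟩ x) := by
    refine listEval_eq f (by simp only [List.length_append, List.length_cons]) fun i hi => ?_
    rcases lt_trichotomy i l₁.length with h | rfl | h
    · simp [h, h.ne]
    · simp
    · obtain ⟨k, rfl⟩ := Nat.exists_eq_add_of_lt h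
      simp [List.getElem_append_right, add_assoc]
  simp only [hupdate]
  exact ((f _).toLinearMap _ _).isLinear

theorem ofFn_update {X : Type*} {n : ℕ} (a : Fin n → X) (i : Fin n) (x : X) :
    List.ofFn (Function.update a i x) =
      (List.ofFn a).take i ++ x :: (List.ofFn a).drop (i + 1) := by
  have h : i < (List.ofFn a).length := List.length_ofFn.symm ▸ i.2
  refine Eq.trans (List.ext_getElem ?_ fun k _ _ => ?_)
    ((List.set_eq_take_append_cons_drop (l := List.ofFn a)).trans (if_pos h))
  · rw [List.length_set, List.length_ofFn, List.length_ofFn]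
  · simp only [List.getElem_ofFn, List.getElem_set, Function.update_apply, Fin.ext_iff, eq_comm]

namespace IsListMultilinear

variable {Φ : List V → W}

/-- The family of multilinear maps given by a multilinear function of finite lists. -/
def toMultilinearMap (h : IsListMultilinear R Φ) (n : ℕ) :
    MultilinearMap R (fun _ : Fin n => V) W where
  toFun a := Φ (List.ofFn a)
  map_update_add' {inst} a i x y := by
    rw [Subsingleton.elim inst (instDecidableEqFin n)]
    simp only [ofFn_update]
    exact (h _ _).map_add x y
  map_update_smul' {inst} a i c x := by
    rw [Subsingleton.elim inst (instDecidableEqFin n)]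
    simp only [ofFn_update]
    exact (h _ _).map_smul c x

theorem listEval_toMultilinearMap (h : IsListMultilinear R Φ) : listEval h.toMultilinearMap = Φ :=
  funext fun l => congrArg Φ (List.ofFn_get l)

end IsListMultilinear

/-- The list of the first `n` terms of a sequence. -/
def listOfSeq {X : Type*} (n : ℕ) (a : ℕ → X) : List X := List.ofFn fun i : Fin n => a i

section ListOfSeq

variable {X : Type*}

theorem length_listOfSeq (n : ℕ) (a : ℕ → X) : (listOfSeq n a).length = n := List.length_ofFn

theorem getElem_listOfSeq (n : ℕ) (a : ℕ → X) (i : ℕ) (h : i < (listOfSeq n a).length) :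
    (listOfSeq n a)[i] = a i := List.getElem_ofFn h

theorem take_listOfSeq {j n : ℕ} (h : j ≤ n) (a : ℕ → X) :
    (listOfSeq n a).take j = listOfSeq j a :=
  List.ext_getElem (by simp only [List.length_take, length_listOfSeq, min_eq_left h])
    fun i _ _ => by simp only [List.getElem_take, getElem_listOfSeq]

theorem drop_listOfSeq (j n : ℕ) (a : ℕ → X) :
    (listOfSeq n a).drop j = listOfSeq (n - j) fun i => a (j + i) :=
  List.ext_getElem (by simp only [List.length_drop, length_listOfSeq])
    fun i _ _ => by simp only [List.getElem_drop, getElem_listOfSeq]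

theorem map_listOfSeq {Y : Type*} (f : X → Y) (n : ℕ) (a : ℕ → X) :
    (listOfSeq n a).map f = listOfSeq n fun i => f (a i) := List.map_ofFn

theorem sum_listOfSeq {X : Type*} [AddCommMonoid X] (n : ℕ) (a : ℕ → X) :
    (listOfSeq n a).sum = ∑ i ∈ Finset.range n, a i := by
  rw [listOfSeq, List.sum_ofFn, Fin.sum_univ_eq_sum_range]

end ListOfSeq

theorem listEval_listOfSeq (f : ∀ n, MultilinearMap R (fun _ : Fin n => V) W) (n : ℕ) (a : ℕ → V) :
    listEval f (listOfSeq n a) = f n fun i => a i :=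
  listEval_eq f (length_listOfSeq n a) fun i hi => getElem_listOfSeq n a i hi

theorem insertSum_listOfSeq {X : Type*} (σ : X → X) (g : List X → X) (Φ : List X → W) (n : ℕ)
    (a : ℕ → X) :
    insertSum σ g Φ (listOfSeq n a) = ∑ m ∈ Finset.Icc 1 n, ∑ j ∈ Finset.range (n - m + 1),
      Φ ((listOfSeq j a).map σ ++ g (listOfSeq m fun i => a (j + i)) ::
        listOfSeq (n - m - j) fun i => a (j + m + i)) := by
  have hshift (j : ℕ) (G : ℕ → W) :
      ∑ i ∈ Finset.range (n - j), G (i + 1) = ∑ m ∈ Finset.Icc 1 (n - j), G m := by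
    rw [Finset.range_eq_Ico, Finset.sum_Ico_add' G 0 (n - j) 1]
    rfl
  simp only [insertSum, headInsertSum, prefixSum, drop_listOfSeq, length_listOfSeq]
  rw [Finset.sum_congr rfl fun j _ => hshift j fun m => Φ (((listOfSeq n a).take j).map σ ++
    g ((listOfSeq (n - j) fun i => a (j + i)).take m) ::
      listOfSeq (n - j - m) fun i => a (j + (m + i)))]
  rw [Finset.sum_comm' (t' := Finset.Icc 1 n) (s' := fun m => Finset.range (n - m + 1))
    fun j m => by simp only [Finset.mem_range, Finset.mem_Icc]; omega]
  refine Finset.sum_congr rfl fun m hm => Finset.sum_congr rfl fun j hj => ?_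
  rw [Finset.mem_Icc] at hm
  rw [Finset.mem_range] at hj
  rw [take_listOfSeq (by omega), take_listOfSeq (by omega), Nat.sub_right_comm]
  simp only [add_assoc]

theorem blockSum_listEval (f : ∀ n, MultilinearMap R (fun _ : Fin n => V) Z)
    (g : ∀ n, MultilinearMap R (fun _ : Fin n => Z) W) (n : ℕ) (a : ℕ → V) :
    blockSum (listEval f) (listEval g) (listOfSeq n a) = ∑ c : Composition n, g c.length
      fun i => f (c.blocksFun i) fun l => a (c.embedding i l) := by
  rw [blockSum_eq_sum_blocks (length_listOfSeq n a)]
  refine Finset.sum_congr rfl fun c _ => ?_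
  refine listEval_eq g (b := fun i => f (c.blocksFun i) fun l => a (c.embedding i l))
    ((List.length_map _).trans (List.length_splitWrtComposition _ c)) fun i hi => ?_
  have hic : i < c.length := by
    rwa [List.length_map, List.length_splitWrtComposition] at hi
  rw [List.getElem_map, List.getElem_splitWrtComposition, take_listOfSeq (c.sizeUpTo_le _),
    drop_listOfSeq]
  refine listEval_eq f ?_ fun k hk => ?_
  · rw [length_listOfSeq, c.sizeUpTo_succ hic, Nat.add_sub_cancel_left]
    rfl
  · rw [getElem_listOfSeq, Composition.coe_embedding]

end MultilinearFamilies

section Grading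

variable {V W : Type*} [AddCommGroup V] [Module ℝ V] [AddCommGroup W] [Module ℝ W]
  {𝒱 : ℤ → Submodule ℝ V} {e : ℤ}

theorem listOfSeq_insertAt {X : Type*} {n j r : ℕ} (hjr : j + r ≤ n) (hr : 1 ≤ r) (a : ℕ → X)
    (x : X) : listOfSeq (n - r + 1) (insertAt a j r x) =
      listOfSeq j a ++ x :: listOfSeq (n - r - j) fun i => a (j + r + i) := by
  refine List.ext_getElem ?_ fun i _ _ => ?_
  · simp only [length_listOfSeq, List.length_append, List.length_cons]
    omega
  · simp only [getElem_listOfSeq, List.getElem_append, List.getElem_cons, length_listOfSeq,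
      insertAt]
    split_ifs
    · rfl
    · rfl
    · omega
    · omega
    · exact congrArg a (by omega)

/-- `σ` multiplies a vector of degree `i` by the sign `(-1)^{e (i - 1)}` that an operation of
reduced degree `e` picks up when it moves past this vector. -/
def IsReducedSign (𝒱 : ℤ → Submodule ℝ V) (e : ℤ) (σ : V → V) : Prop :=
  ∀ i, ∀ x ∈ 𝒱 i, σ x = (-1 : ℝ) ^ (e * (i - 1)) • x

theorem isReducedSign_id : IsReducedSign 𝒱 0 id := fun i x _ => by
  rw [zero_mul, zpow_zero, one_smul, id]

theorem exists_isReducedSign (h𝒱 : DirectSum.IsInternal 𝒱) (e : ℤ) :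
    ∃ ε : V →ₗ[ℝ] V, IsReducedSign 𝒱 e ε := by
  let decomp := LinearEquiv.ofBijective (DirectSum.coeLinearMap 𝒱) h𝒱
  refine ⟨DirectSum.toModule ℝ ℤ V (fun i => (-1 : ℝ) ^ (e * (i - 1)) • (𝒱 i).subtype) ∘ₗ
    decomp.symm.toLinearMap, fun i x hx => ?_⟩
  have hdecomp : decomp.symm x = DirectSum.lof ℝ ℤ (fun i => 𝒱 i) i ⟨x, hx⟩ :=
    (LinearEquiv.symm_apply_eq _).2 (DirectSum.coeLinearMap_lof 𝒱 i ⟨x, hx⟩).symm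
  rw [LinearMap.comp_apply, LinearEquiv.coe_coe, hdecomp, DirectSum.toModule_lof]
  rfl

variable {σ : V → V} {deg : ℕ → ℤ} {a : ℕ → V}

theorem IsReducedSign.map_append (hσ : IsReducedSign 𝒱 e σ) {Φ : List V → W}
    (hΦ : IsListMultilinear ℝ Φ) (l : List (Σ i, 𝒱 i)) (l' : List V) :
    Φ ((l.map fun x => (x.2 : V)).map σ ++ l') =
      (-1 : ℝ) ^ (e * (l.map fun x => x.1 - 1).sum) • Φ ((l.map fun x => (x.2 : V)) ++ l') := by
  induction l generalizing Φ with
  | nil => simp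
  | cons x l ih =>
    simp only [List.map_cons, List.sum_cons, List.cons_append]
    rw [ih (hΦ.cons _), hσ _ _ x.2.2, (hΦ.head _).map_smul, smul_smul, ← zpow_add₀ (by norm_num),
      add_comm, mul_add]

theorem IsReducedSign.map_listOfSeq_append (hσ : IsReducedSign 𝒱 e σ) {Φ : List V → W}
    (hΦ : IsListMultilinear ℝ Φ) (ha : ∀ i, a i ∈ 𝒱 (deg i)) (j : ℕ) (l : List V) :
    Φ ((listOfSeq j a).map σ ++ l) = (-1 : ℝ) ^ (e * maltese deg j) • Φ (listOfSeq j a ++ l) := by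
  simpa only [map_listOfSeq, sum_listOfSeq, maltese] using
    hσ.map_append hΦ (listOfSeq j fun i => ⟨deg i, a i, ha i⟩) l

theorem sum_gComp (hσ : IsReducedSign 𝒱 e σ)
    (f : ∀ n, MultilinearMap ℝ (fun _ : Fin n => V) W)
    (g : ∀ n, MultilinearMap ℝ (fun _ : Fin n => V) V) (n : ℕ) (ha : ∀ i, a i ∈ 𝒱 (deg i)) :
    ∑ m ∈ Finset.Icc 1 n, gComp (f (n - m + 1)) (g m) e deg a =
      insertSum σ (listEval g) (listEval f) (listOfSeq n a) := by
  rw [insertSum_listOfSeq]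
  refine Finset.sum_congr rfl fun m hm => Finset.sum_congr rfl fun j hj => ?_
  rw [Finset.mem_Icc] at hm
  rw [Finset.mem_range] at hj
  rw [hσ.map_listOfSeq_append (isListMultilinear_listEval f) ha,
    ← listOfSeq_insertAt (by omega) hm.1, listEval_listOfSeq, listEval_listOfSeq]

theorem gComp_zero {k r : ℕ} (f : MultilinearMap ℝ (fun _ : Fin k => V) W) (e : ℤ)
    (deg : ℕ → ℤ) (a : ℕ → V) :
    gComp f (0 : MultilinearMap ℝ (fun _ : Fin r => V) V) e deg a = 0 := by
  refine Finset.sum_eq_zero fun j hj => ?_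
  rw [f.map_coord_zero ⟨j, Finset.mem_range.1 hj⟩ (by simp [insertAt]), smul_zero]

theorem sum_antidiagonal_gComp (f : ∀ n, MultilinearMap ℝ (fun _ : Fin n => V) W)
    {g : ∀ n, MultilinearMap ℝ (fun _ : Fin n => V) V} (hg : g 0 = 0) (n : ℕ) (e : ℤ)
    (deg : ℕ → ℤ) (a : ℕ → V) :
    ∑ kr ∈ Finset.HasAntidiagonal.antidiagonal (n + 1), gComp (f kr.1) (g kr.2) e deg a =
      ∑ m ∈ Finset.Icc 1 n, gComp (f (n - m + 1)) (g m) e deg a := by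
  symm
  refine Finset.sum_of_injOn (fun m => (n - m + 1, m)) (fun m _ m' _ h => congrArg Prod.snd h)
    (fun m hm => ?_) ?_ fun _ _ => rfl
  · rw [Finset.mem_coe, Finset.mem_Icc] at hm
    rw [Finset.mem_coe, Finset.HasAntidiagonal.mem_antidiagonal]
    dsimp only
    omega
  · rintro ⟨k, r⟩ hkr hnot
    rw [Finset.HasAntidiagonal.mem_antidiagonal] at hkr
    obtain rfl | rfl : r = 0 ∨ k = 0 := by
      by_contra! hne
      exact hnot ⟨r, by simp only [Finset.coe_Icc, Set.mem_Icc]; omega,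
        Prod.ext (by dsimp only; omega) rfl⟩
    · rw [hg, gComp_zero]
    · exact Finset.sum_empty

end Grading

section Homogeneous

variable {V : Type*} [AddCommGroup V] [Module ℝ V] {𝒱 : ℤ → Submodule ℝ V} {e : ℤ}

/-- `Φ` maps lists of homogeneous vectors of total reduced degree `d` to vectors of degree `d + e`,
hence of reduced degree `d + e - 1`. A list of homogeneous vectors is encoded by a list of pairs of
a degree and a vector of this degree. -/
def IsListHomogeneous (𝒱 : ℤ → Submodule ℝ V) (e : ℤ) (Φ : List V → V) : Prop :=
  ∀ l : List (Σ i, 𝒱 i), Φ (l.map fun x => (x.2 : V)) ∈ 𝒱 ((l.map fun x => x.1 - 1).sum + e)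

theorem isListHomogeneous_single : IsListHomogeneous 𝒱 1 single := by
  intro l
  match l with
  | [] => exact Submodule.zero_mem _
  | [x] => simp [single]
  | _ :: _ :: _ => exact Submodule.zero_mem _

namespace IsListHomogeneous

theorem insertSum {g Φ : List V → V} (hg : IsListHomogeneous 𝒱 1 g)
    (hΦ : IsListHomogeneous 𝒱 e Φ) : IsListHomogeneous 𝒱 e (insertSum id g Φ) := by
  intro l
  simp only [AInfFamily.insertSum, headInsertSum, prefixSum]
  refine Submodule.sum_mem _ fun j _ => Submodule.sum_mem _ fun m _ => ?_
  simp only [← List.map_drop, ← List.map_take, List.map_id]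
  set l₁ := l.take j
  set l₂ := (l.drop j).take (m + 1)
  set l₃ := (l.drop j).drop (m + 1)
  have hl : l = l₁ ++ (l₂ ++ l₃) := by rw [List.take_append_drop, List.take_append_drop]
  have hmem := hΦ (l₁ ++ ⟨_, _, hg l₂⟩ :: l₃)
  simp only [List.map_append, List.map_cons, List.sum_append, List.sum_cons] at hmem
  convert hmem using 2
  rw [hl]
  simp only [List.map_append, List.sum_append]
  ring

theorem treeTransport {A : ℝ → List V → V} {a b p q : ℝ} (hA : IsConnection A (Set.Icc a b))
    (hh : ∀ t ∈ Set.Icc a b, IsListHomogeneous 𝒱 1 (A t)) (hp : p ∈ Set.Icc a b)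
    (hq : q ∈ Set.Icc a b) : IsListHomogeneous 𝒱 1 (treeTransport A q p) := by
  have htree (k : ℕ) (p : ℝ) (hp : p ∈ Set.Icc a b) :
      IsListHomogeneous 𝒱 1 (treeIntegral A q k p) := by
    induction k generalizing p with
    | zero => exact isListHomogeneous_single
    | succ k ih =>
      have hsub := Set.uIcc_subset_Icc hp hq
      have hcont := weaklyContinuousOn_insertSum_treeIntegral hA hq k
      exact fun l => ((hcont _).mono hsub).weakIntegral_mem fun t ht =>
        (hh t (hsub ht)).insertSum (ih t (hsub ht)) l
  exact fun l => Submodule.sum_mem _ fun k _ => Submodule.smul_mem _ _ (htree k p hp l)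

theorem listEval {f : ∀ n, MultilinearMap ℝ (fun _ : Fin n => V) V}
    (hf : ∀ n : ℕ, IsHomogeneous 𝒱 𝒱 (f n) (e - n)) : IsListHomogeneous 𝒱 e (listEval f) := by
  intro l
  have hdeg := hf l.length (fun i => l[i].1) (fun i => l[i].2) fun i => l[i].2.2
  rw [listEval_eq f (List.length_map _) (b := fun i => l[i].2) fun i hi => List.getElem_map _]
  convert hdeg using 2
  have hsum := Fin.sum_univ_fun_getElem l fun x => x.1 - 1
  rw [Finset.sum_sub_distrib, Fin.sum_const, nsmul_one] at hsum
  rw [← hsum]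
  simp only [Fin.getElem_fin]
  ring

theorem isHomogeneous {Φ : List V → V} (hΦ : IsListHomogeneous 𝒱 e Φ) (h : IsListMultilinear ℝ Φ)
    (n : ℕ) : IsHomogeneous 𝒱 𝒱 (h.toMultilinearMap n) (e - n) := by
  intro deg a ha
  have hdeg := hΦ (List.ofFn fun i => ⟨deg i, a i, ha i⟩)
  rw [List.map_ofFn, List.map_ofFn, List.sum_ofFn] at hdeg
  change Φ (List.ofFn a) ∈ _ at hdeg ⊢
  convert hdeg using 2
  simp only [Function.comp_apply, Finset.sum_sub_distrib, Fin.sum_const, nsmul_one]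
  ring

end IsListHomogeneous

theorem forall_list_of_homogeneous (h𝒱 : ⨆ i, 𝒱 i = ⊤) {P : List V → Prop}
    (hzero : ∀ l₁ l₂, P (l₁ ++ 0 :: l₂))
    (hadd : ∀ l₁ l₂ x y, P (l₁ ++ x :: l₂) → P (l₁ ++ y :: l₂) → P (l₁ ++ (x + y) :: l₂))
    (hP : ∀ l : List (Σ i, 𝒱 i), P (l.map fun x => (x.2 : V))) (l : List V) : P l := by
  suffices ∀ l₁ : List (Σ i, 𝒱 i), P ((l₁.map fun x => (x.2 : V)) ++ l) from this []
  induction l with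
  | nil => exact fun l₁ => by simpa only [List.append_nil] using hP l₁
  | cons x w ih =>
    intro l₁
    have hx : x ∈ ⨆ i, 𝒱 i := h𝒱 ▸ Submodule.mem_top
    induction hx using Submodule.iSup_induction' with
    | mem i x hx =>
      have h := ih (l₁ ++ [⟨i, x, hx⟩])
      rwa [List.map_append, List.append_assoc] at h
    | zero => exact hzero _ _
    | add x y _ _ hx hy => exact hadd _ _ _ _ hx hy

theorem IsListHomogeneous.map_sign (h𝒱 : ⨆ i, 𝒱 i = ⊤) {ε : V →ₗ[ℝ] V}
    (hε : IsReducedSign 𝒱 e ε) {Φ : List V → V} (hΦ : IsListMultilinear ℝ Φ)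
    (hh : IsListHomogeneous 𝒱 1 Φ) (l : List V) : Φ (l.map ε) = ε (Φ l) := by
  refine forall_list_of_homogeneous h𝒱 (P := fun l => Φ (l.map ε) = ε (Φ l)) ?_ ?_ ?_ l
  · intro l₁ l₂
    rw [hΦ.eq_zero_of_mem (l := l₁ ++ 0 :: l₂) (by simp), hΦ.eq_zero_of_mem (by simp), map_zero]
  · intro l₁ l₂ x y hx hy
    simp only [List.map_append, List.map_cons, map_add] at hx hy ⊢
    rw [(hΦ _ _).map_add, (hΦ l₁ l₂).map_add, hx, hy, map_add]
  · intro l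
    simpa only [List.append_nil, hε _ _ (hh l), add_sub_cancel_right] using
      IsReducedSign.map_append hε hΦ l []

end Homogeneous

section Trees

variable {V : Type*} [AddCommGroup V] [Module ℝ V] {a b p q : ℝ}

/-- `y` is the iterated integral of `T` over the simplex `p ≤ t₁ ≤ ⋯ ≤ t_k ≤ q` (oriented if
`p > q`), and all the vector-valued integrals on the way exist and have continuous integrands. -/
def IsSimplexIntegral (q : ℝ) : (k : ℕ) → (p : ℝ) → ((Fin k → ℝ) → V) → V → Prop
  | 0, _, T, y => y = T Fin.elim0
  | k + 1, p, T, y => ∃ Y : ℝ → V, WeaklyContinuousOn Y (Set.uIcc p q) ∧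
      (∀ s ∈ Set.uIcc p q, IsSimplexIntegral q k s (fun t => T (Fin.cons s t)) (Y s)) ∧
      ∀ φ : Module.Dual ℝ V, φ y = ∫ s in p..q, φ (Y s)

namespace IsSimplexIntegral

theorem dual_eq {k : ℕ} {T : (Fin k → ℝ) → V} {y : V} (h : IsSimplexIntegral q k p T y)
    (φ : Module.Dual ℝ V) : φ y = simplexIntegral k p q fun t => φ (T t) := by
  induction k generalizing p y with
  | zero => exact congrArg φ h
  | succ k ih =>
    obtain ⟨Y, -, hY, hy⟩ := h
    exact (hy φ).trans (intervalIntegral.integral_congr fun s hs => ih (hY s hs))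

theorem sum {ι : Type*} {u : Finset ι} {k : ℕ} {T : ι → (Fin k → ℝ) → V} {y : ι → V}
    (h : ∀ i ∈ u, IsSimplexIntegral q k p (T i) (y i)) :
    IsSimplexIntegral q k p (fun t => ∑ i ∈ u, T i t) (∑ i ∈ u, y i) := by
  induction k generalizing p y with
  | zero => exact Finset.sum_congr rfl h
  | succ k ih =>
    choose! Y hcont hY hy using h
    refine ⟨fun s => ∑ i ∈ u, Y i s, .sum hcont, fun s hs => ih fun i hi => hY i hi s hs,
      fun φ => ?_⟩
    simp only [map_sum]
    rw [intervalIntegral.integral_finsetSum fun i hi => (hcont i hi φ).intervalIntegrable]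
    exact Finset.sum_congr rfl fun i hi => hy i hi φ

theorem insertSum {W : Type*} {k : ℕ} {σ : W → W} {g : List W → W} {Φ : (Fin k → ℝ) → List W → V}
    {Ψ : List W → V} (h : ∀ l, IsSimplexIntegral q k p (fun t => Φ t l) (Ψ l)) (l : List W) :
    IsSimplexIntegral q k p (fun t => insertSum σ g (Φ t) l) (insertSum σ g Ψ l) := by
  simp only [AInfFamily.insertSum, headInsertSum, prefixSum]
  exact .sum fun _ _ => .sum fun _ _ => h _

end IsSimplexIntegral

/-- The sum of all trees with `k` levels, as a function of finite lists. -/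
def listTreeSum (A : ℝ → List V → V) : (k : ℕ) → (Fin k → ℝ) → List V → V
  | 0, _ => single
  | k + 1, t => insertSum id (A (t 0)) (listTreeSum A k (Fin.tail t))

theorem listTreeSum_listOfSeq (A : ℝ → ∀ r : ℕ, MultilinearMap ℝ (fun _ : Fin r => V) V) (k n : ℕ)
    (t : Fin k → ℝ) (x : ℕ → V) :
    listTreeSum (fun s => listEval (A s)) k t (listOfSeq n x) = treeSum A k n t x := by
  induction k generalizing n x with
  | zero =>
    rw [treeSum, listTreeSum]
    split_ifs with h
    · subst h
      rfl
    · exact single_of_length_ne (by rwa [length_listOfSeq])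
  | succ k ih =>
    rw [treeSum, listTreeSum, insertSum_listOfSeq]
    refine Finset.sum_congr rfl fun m hm => Finset.sum_congr rfl fun j hj => ?_
    rw [Finset.mem_Icc] at hm
    rw [Finset.mem_range] at hj
    rw [← ih, List.map_id, listOfSeq_insertAt (by omega) hm.1, listEval_listOfSeq]

theorem isSimplexIntegral_treeIntegral {A : ℝ → List V → V} (hA : IsConnection A (Set.Icc a b))
    (hp : p ∈ Set.Icc a b) (hq : q ∈ Set.Icc a b) (k : ℕ) (l : List V) :
    IsSimplexIntegral q k p (fun t => listTreeSum A k t l) (treeIntegral A q k p l) := by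
  induction k generalizing p l with
  | zero => exact rfl
  | succ k ih =>
    have hsub := Set.uIcc_subset_Icc hp hq
    have hcont := (weaklyContinuousOn_insertSum_treeIntegral hA hq k l).mono hsub
    refine ⟨_, hcont, fun s hs => ?_, hcont.dual_weakIntegral⟩
    simp only [listTreeSum, Fin.cons_zero, Fin.tail_cons]
    exact .insertSum (fun l => ih (hsub hs) l) l

theorem dual_treeTransport {A : ℝ → List V → V} (hA : IsConnection A (Set.Icc a b))
    (hp : p ∈ Set.Icc a b) (hq : q ∈ Set.Icc a b) {N : ℕ} {l : List V} (hl : l.length ≤ N)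
    (φ : Module.Dual ℝ V) : φ (treeTransport A q p l) = ∑ i ∈ Finset.range N,
      (-1 : ℝ) ^ i * simplexIntegral i p q fun t => φ (listTreeSum A i t l) := by
  simp only [treeTransport_eq_sum hA hp hq hl, map_sum, map_smul, smul_eq_mul,
    (isSimplexIntegral_treeIntegral hA hp hq _ l).dual_eq φ]

end Trees

section Morphism

variable {V : Type*} [AddCommGroup V] [Module ℝ V] {𝒱 : ℤ → Submodule ℝ V} {a b p q : ℝ}

theorem listOfSeq_getD {X : Type*} (l : List X) (d : X) :
    listOfSeq l.length (fun i => l.getD i d) = l :=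
  List.ext_getElem (length_listOfSeq _ _) fun i _ h => by
    rw [getElem_listOfSeq, List.getD_eq_getElem _ _ h]

theorem hasWeakDerivOn_of_forall_homogeneous (h𝒱 : ⨆ i, 𝒱 i = ⊤) {s : Set ℝ}
    {f f' : ℝ → List V → V} (hf : ∀ t ∈ s, IsListMultilinear ℝ (f t))
    (hf' : ∀ t ∈ s, IsListMultilinear ℝ (f' t))
    (h : ∀ (n : ℕ) (deg : ℕ → ℤ) (x : ℕ → V), (∀ i, x i ∈ 𝒱 (deg i)) →
      HasWeakDerivOn (fun t => f t (listOfSeq n x)) (fun t => f' t (listOfSeq n x)) s)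
    (l : List V) : HasWeakDerivOn (fun t => f t l) (fun t => f' t l) s := by
  refine forall_list_of_homogeneous h𝒱
    (P := fun l => HasWeakDerivOn (fun t => f t l) (fun t => f' t l) s) ?_ ?_ ?_ l
  · exact fun l₁ l₂ => (HasWeakDerivOn.const 0).congr (fun t ht => (hf t ht l₁ l₂).map_zero)
      fun t ht => (hf' t ht l₁ l₂).map_zero
  · exact fun l₁ l₂ x y hx hy => (hx.add hy).congr (fun t ht => (hf t ht l₁ l₂).map_add x y)
      fun t ht => (hf' t ht l₁ l₂).map_add x y
  · intro l
    rw [← listOfSeq_getD l ⟨0, 0⟩, map_listOfSeq]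
    exact h _ _ _ fun i => (l.getD i ⟨0, 0⟩).2.2

theorem isAInfMorphism_treeTransport {A μ : ℝ → ∀ n, MultilinearMap ℝ (fun _ : Fin n => V) V}
    (hA : IsConnection (fun t => listEval (A t)) (Set.Icc a b))
    (hAdeg : ∀ t ∈ Set.Icc a b, ∀ n : ℕ, IsHomogeneous 𝒱 𝒱 (A t n) (1 - n))
    (hderiv : ∀ (n : ℕ) (deg : ℕ → ℤ) (x : ℕ → V), (∀ i, x i ∈ 𝒱 (deg i)) →
      HasWeakDerivOn (fun t => μ t n fun i => x i)
        (fun t => ∑ m ∈ Finset.Icc 1 n, gComp (μ t (n - m + 1)) (A t m) 0 deg x -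
          ∑ m ∈ Finset.Icc 1 n, gComp (A t (n - m + 1)) (μ t m) 1 deg x) (Set.Icc a b))
    (hp : p ∈ Set.Icc a b) (hq : q ∈ Set.Icc a b) (hμp : IsAInfAlgebra 𝒱 (μ p))
    (hμq : IsAInfAlgebra 𝒱 (μ q)) : IsAInfMorphism 𝒱 𝒱 (μ p) (μ q)
      (isListMultilinear_treeTransport hA hp hq).toMultilinearMap := by
  have h𝒱 := hμp.internal.submodule_iSup_eq_top
  obtain ⟨ε, hε⟩ := exists_isReducedSign hμp.internal 1
  have hAlist t ht : IsListHomogeneous 𝒱 1 (listEval (A t)) := .listEval (hAdeg t ht)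
  have hμ t : IsListMultilinear ℝ (listEval (μ t)) := isListMultilinear_listEval (μ t)
  have hsign t ht := (hAlist t ht).map_sign h𝒱 hε (hA.isListMultilinear t ht)
  have hid : IsLinearMap ℝ (id : V → V) := LinearMap.id.isLinear
  have hflow := hasWeakDerivOn_of_forall_homogeneous h𝒱 (fun t _ => hμ t)
    (fun t ht => ((hA.isListMultilinear t ht).insertSum hid (hμ t)).sub
      ((hμ t).insertSum ε.isLinear (hA.isListMultilinear t ht)))
    fun n deg x hx => by
      simpa only [listEval_listOfSeq, ← sum_gComp isReducedSign_id _ _ n hx,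
        ← sum_gComp hε _ _ n hx] using hderiv n deg x hx
  refine ⟨hμp, hμq, fun n _ => (IsListHomogeneous.treeTransport hA hAlist hp hq).isHomogeneous _ n,
    fun n hn deg x hx => ?_⟩
  rw [← blockSum_listEval, sum_gComp hε _ _ n hx, IsListMultilinear.listEval_toMultilinearMap]
  exact sub_eq_zero.1 (transportDefect_eq_zero hA ε.isLinear hsign (fun t _ => hμ t) hflow hp hq
    (List.ne_nil_of_length_pos (by rwa [length_listOfSeq])))

end Morphism

section Conjugation

theorem map_insertAt {X V : Type*} (f : X → V) (a : ℕ → X) (j r : ℕ) (x : X) (i : ℕ) :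
    f (insertAt a j r x i) = insertAt (fun i => f (a i)) j r (f x) i := by
  unfold insertAt
  split_ifs <;> rfl

variable {V W X Y : Type*} [AddCommGroup V] [Module ℝ V] [AddCommGroup W] [Module ℝ W]
  [AddCommGroup X] [Module ℝ X] [AddCommGroup Y] [Module ℝ Y]
  {𝒱 : ℤ → Submodule ℝ V} {𝒲 : ℤ → Submodule ℝ W} {𝒳 : ℤ → Submodule ℝ X}
  {𝒴 : ℤ → Submodule ℝ Y} {e : X ≃ₗ[ℝ] V} {e' : Y ≃ₗ[ℝ] W}

/-- `e` is an isomorphism of graded vector spaces. -/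
def IsGradedEquiv (𝒳 : ℤ → Submodule ℝ X) (𝒱 : ℤ → Submodule ℝ V) (e : X ≃ₗ[ℝ] V) : Prop :=
  ∀ i x, e x ∈ 𝒱 i ↔ x ∈ 𝒳 i

namespace IsGradedEquiv

theorem symm (he : IsGradedEquiv 𝒳 𝒱 e) : IsGradedEquiv 𝒱 𝒳 e.symm := fun i v => by
  rw [← he, LinearEquiv.apply_symm_apply]

theorem isInternal (he : IsGradedEquiv 𝒳 𝒱 e) (h : DirectSum.IsInternal 𝒳) :
    DirectSum.IsInternal 𝒱 := by
  have hmap : 𝒱 = Submodule.orderIsoMapComap e ∘ 𝒳 := by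
    funext i
    ext v
    simp [Submodule.orderIsoMapComap, Submodule.mem_map_equiv, he.symm i v]
  rw [DirectSum.isInternal_submodule_iff_iSupIndep_and_iSup_eq_top] at h ⊢
  rw [hmap, iSupIndep_map_orderIso_iff]
  exact ⟨h.1, (map_iSup (Submodule.orderIsoMapComap e) 𝒳).symm.trans (h.2 ▸ OrderIso.map_top _)⟩

end IsGradedEquiv

/-- A multilinear map transported along linear equivalences of the source and the target. -/
def conj (e : X ≃ₗ[ℝ] V) (e' : Y ≃ₗ[ℝ] W) {n : ℕ} (f : MultilinearMap ℝ (fun _ : Fin n => X) Y) :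
    MultilinearMap ℝ (fun _ : Fin n => V) W :=
  e'.toLinearMap.compMultilinearMap (f.compLinearMap fun _ => e.symm.toLinearMap)

theorem conj_apply (e : X ≃ₗ[ℝ] V) (e' : Y ≃ₗ[ℝ] W) {n : ℕ}
    (f : MultilinearMap ℝ (fun _ : Fin n => X) Y) (a : Fin n → V) :
    conj e e' f a = e' (f fun i => e.symm (a i)) := rfl

theorem conj_symm_conj (e : X ≃ₗ[ℝ] V) (e' : Y ≃ₗ[ℝ] W) {n : ℕ}
    (f : MultilinearMap ℝ (fun _ : Fin n => X) Y) : conj e.symm e'.symm (conj e e' f) = f := by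
  ext a
  simp only [conj_apply, LinearEquiv.symm_symm, LinearEquiv.symm_apply_apply]

theorem gComp_conj (e : X ≃ₗ[ℝ] V) (e' : Y ≃ₗ[ℝ] W) {k r : ℕ}
    (f : MultilinearMap ℝ (fun _ : Fin k => X) Y) (g : MultilinearMap ℝ (fun _ : Fin r => X) X)
    (d : ℤ) (deg : ℕ → ℤ) (a : ℕ → V) :
    gComp (conj e e' f) (conj e e g) d deg a = e' (gComp f g d deg fun i => e.symm (a i)) := by
  simp only [gComp, map_sum, map_smul, conj_apply, map_insertAt e.symm,
    LinearEquiv.symm_apply_apply]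

theorem IsHomogeneous.conj (he : IsGradedEquiv 𝒳 𝒱 e) (he' : IsGradedEquiv 𝒴 𝒲 e') {n : ℕ}
    {f : MultilinearMap ℝ (fun _ : Fin n => X) Y} {k : ℤ} (hf : IsHomogeneous 𝒳 𝒴 f k) :
    IsHomogeneous 𝒱 𝒲 (conj e e' f) k :=
  fun deg _ ha => (he' _ _).2 (hf deg _ fun i => (he.symm _ _).2 (ha i))

theorem IsAInfAlgebra.conj {μ : ∀ n, MultilinearMap ℝ (fun _ : Fin n => X) X}
    (he : IsGradedEquiv 𝒳 𝒱 e) (h : IsAInfAlgebra 𝒳 μ) :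
    IsAInfAlgebra 𝒱 fun n => conj e e (μ n) where
  internal := he.isInternal h.internal
  homogeneous n := (h.homogeneous n).conj he he
  relation n deg a ha := by
    simp only [gComp_conj, ← map_sum]
    rw [h.relation n deg _ fun i => (he.symm _ _).2 (ha i), map_zero]

theorem IsAInfMorphism.conj {μX : ∀ n, MultilinearMap ℝ (fun _ : Fin n => X) X}
    {μY : ∀ n, MultilinearMap ℝ (fun _ : Fin n => Y) Y}
    {F : ∀ n, MultilinearMap ℝ (fun _ : Fin n => X) Y} (he : IsGradedEquiv 𝒳 𝒱 e)
    (he' : IsGradedEquiv 𝒴 𝒲 e') (h : IsAInfMorphism 𝒳 𝒴 μX μY F) :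
    IsAInfMorphism 𝒱 𝒲 (fun n => conj e e (μX n)) (fun n => conj e' e' (μY n))
      fun n => conj e e' (F n) where
  source := h.source.conj he
  target := h.target.conj he'
  homogeneous n hn := (h.homogeneous n hn).conj he he'
  relation n hn deg a ha := by
    simp only [gComp_conj, ← map_sum]
    rw [← h.relation n hn deg _ fun i => (he.symm _ _).2 (ha i), map_sum]
    simp only [conj_apply, LinearEquiv.symm_apply_apply]

end Conjugation

/-! ### The Maurer–Cartan equation along a path -/

section SelfBracket

variable {E : Type*} [NormedAddCommGroup E] [NormedSpace ℝ E]
  {H : Type*} [TopologicalSpace H] {I : ModelWithCorners ℝ E H}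
  {M : Type*} [TopologicalSpace M] [ChartedSpace H M]
  {V : Type*} [AddCommGroup V] [Module ℝ V] {𝒱 : ℤ → Submodule ℝ V}
  {L : LocalSystem M 𝒱}

theorem eq_structureMaps (α : HochschildForm I L) (n : ℕ) (x : M) (v : Fin 0 → TangentSpace I x) :
    α 0 n x v = structureMaps α x n :=
  congrArg (α 0 n x) (Subsingleton.elim _ _)

theorem selfBracket_zero (α : HochschildForm I L) (n : ℕ) (x : M) (v : Fin 0 → TangentSpace I x)
    (deg : ℕ → ℤ) (a : ℕ → L.fiber x) :
    selfBracket α 0 n x v deg a = (2 : ℝ) •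
      ∑ kr ∈ Finset.HasAntidiagonal.antidiagonal (n + 1),
        gComp (structureMaps α x kr.1) (structureMaps α x kr.2) 1 deg a := by
  have hswap := Finset.Nat.sum_antidiagonal_swap (n := n + 1)
    (f := fun kr => gComp (structureMaps α x kr.1) (structureMaps α x kr.2) 1 deg a)
  calc selfBracket α 0 n x v deg a
    _ = ∑ kr ∈ Finset.HasAntidiagonal.antidiagonal (n + 1),
        gBracket (structureMaps α x kr.1) (structureMaps α x kr.2) 1 1 deg a := by
      refine (Fintype.sum_subsingleton _ (0 : Fin 1)).trans (Finset.sum_congr rfl fun kr _ => ?_)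
      rw [Fintype.sum_subsingleton _ (1 : Equiv.Perm (Fin 0))]
      simp [eq_structureMaps]
    _ = _ := by
      simp only [gBracket, mul_one, zpow_one, neg_smul, one_smul, sub_neg_eq_add,
        Finset.sum_add_distrib, two_smul]
      exact congrArg _ hswap

theorem selfBracket_one (α : HochschildForm I L) (n : ℕ) (x : M) (u : TangentSpace I x)
    (deg : ℕ → ℤ) (a : ℕ → L.fiber x) :
    selfBracket α 1 n x (fun _ => u) deg a = (2 : ℝ) •
      (∑ kr ∈ Finset.HasAntidiagonal.antidiagonal (n + 1),
        gComp (α 1 kr.1 x fun _ => u) (structureMaps α x kr.2) 1 deg a -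
      ∑ kr ∈ Finset.HasAntidiagonal.antidiagonal (n + 1),
        gComp (structureMaps α x kr.1) (α 1 kr.2 x fun _ => u) 0 deg a) := by
  have hswap (f : ℕ → ℕ → L.fiber x) :
      ∑ kr ∈ Finset.HasAntidiagonal.antidiagonal (n + 1), f kr.2 kr.1 =
        ∑ kr ∈ Finset.HasAntidiagonal.antidiagonal (n + 1), f kr.1 kr.2 :=
    Finset.Nat.sum_antidiagonal_swap (f := fun kr => f kr.1 kr.2)
  calc selfBracket α 1 n x (fun _ => u) deg a
    _ = ∑ kr ∈ Finset.HasAntidiagonal.antidiagonal (n + 1),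
          -gBracket (structureMaps α x kr.1) (α 1 kr.2 x fun _ => u) 1 0 deg a +
        ∑ kr ∈ Finset.HasAntidiagonal.antidiagonal (n + 1),
          gBracket (α 1 kr.1 x fun _ => u) (structureMaps α x kr.2) 0 1 deg a := by
      refine (Fin.sum_univ_two _).trans (congrArg₂ _ (Finset.sum_congr rfl fun kr _ => ?_)
        (Finset.sum_congr rfl fun kr _ => ?_)) <;>
      · rw [Fintype.sum_subsingleton _ (1 : Equiv.Perm (Fin 1))]
        simp [eq_structureMaps]
    _ = _ := by
      simp only [gBracket, mul_zero, zero_mul, zpow_zero, one_smul, neg_sub,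
        Finset.sum_sub_distrib, two_smul]
      rw [hswap fun k r => gComp (α 1 k x fun _ => u) (structureMaps α x r) 1 deg a,
        hswap fun k r => gComp (structureMaps α x k) (α 1 r x fun _ => u) 0 deg a]

theorem isAInfAlgebra_structureMaps {α : HochschildForm I L} (h𝒱 : DirectSum.IsInternal 𝒱)
    (hα : IsMaurerCartan α) (x : M) : IsAInfAlgebra (L.grading x) (structureMaps α x) := by
  obtain ⟨b, hb⟩ := L.exists_mem_baseSet x
  have hgraded : IsGradedEquiv (L.grading x) 𝒱 (L.triv b x) := L.triv_mem_iff b x hb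
  refine ⟨hgraded.symm.isInternal h𝒱, fun n => ?_, fun n deg a ha => ?_⟩
  · simpa only [structureMaps, Nat.cast_zero, sub_zero] using hα.homogeneous 0 n x Fin.elim0
  · refine (L.triv b x).map_eq_zero_iff.1 (eq_of_forall_dual_eq fun φ => ?_)
    have hMC := hα.equation 0 n b x hb φ deg (fun i => L.triv b x (a i))
      (fun i => (hgraded _ _).2 (ha i)) Fin.elim0
    simp only [LinearEquiv.symm_apply_apply, selfBracket_zero, map_smul, covariantDeriv,
      zero_add, smul_eq_mul] at hMC
    linarith [map_zero φ]

end SelfBracket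

section Paths

variable {E : Type*} [NormedAddCommGroup E] [NormedSpace ℝ E]
  {H : Type*} [TopologicalSpace H] {I : ModelWithCorners ℝ E H}
  {M : Type*} [TopologicalSpace M] [ChartedSpace H M]
  {V : Type*} [AddCommGroup V] [Module ℝ V] {𝒱 : ℤ → Submodule ℝ V}
  {L : LocalSystem M 𝒱}

/-- The velocity at time `t` of the path `γ : [0, 1] → M`, one-sided at the endpoints. -/
def velocity (I : ModelWithCorners ℝ E H) (γ : ℝ → M) (t : ℝ) : TangentSpace I (γ t) :=
  mfderivWithin 𝓘(ℝ, ℝ) I γ (Set.Icc 0 1) t (1 : ℝ)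

variable {γ : ℝ → M}

theorem mfderiv_extChartAt_velocity [IsManifold I 1 M] {x : M} {t : ℝ}
    (hγ : MDifferentiableWithinAt 𝓘(ℝ, ℝ) I γ (Set.Icc 0 1) t) (ht : t ∈ Set.Icc (0 : ℝ) 1)
    (hx : γ t ∈ (extChartAt I x).source) :
    mfderiv I 𝓘(ℝ, E) (extChartAt I x) (γ t) (velocity I γ t) =
      derivWithin (extChartAt I x ∘ γ) (Set.Icc 0 1) t := by
  rw [extChartAt_source] at hx
  have hchain := mfderiv_comp_mfderivWithin t (mdifferentiableAt_extChartAt hx) hγ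
    ((uniqueDiffOn_Icc zero_lt_one).uniqueMDiffOn t ht)
  rw [mfderivWithin_eq_fderivWithin] at hchain
  exact (DFunLike.congr_fun hchain (1 : ℝ)).symm

theorem mfderivWithin_extChartAt_symm_derivWithin [IsManifold I 1 M] {x : M} {t : ℝ}
    (hγ : MDifferentiableWithinAt 𝓘(ℝ, ℝ) I γ (Set.Icc 0 1) t) (ht : t ∈ Set.Icc (0 : ℝ) 1)
    (hx : γ t ∈ (extChartAt I x).source) :
    mfderivWithin 𝓘(ℝ, E) I (extChartAt I x).symm (Set.range I) (extChartAt I x (γ t))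
      (derivWithin (extChartAt I x ∘ γ) (Set.Icc 0 1) t : E) = (velocity I γ t : E) :=
  (congrArg _ (mfderiv_extChartAt_velocity hγ ht hx)).symm.trans
    (DFunLike.congr_fun (mfderivWithin_extChartAt_symm_comp_mfderiv_extChartAt' hx) _)

/-- The pairing of `φ` with `α^{m,n}(a₁, …, aₙ)` at `y` on the tangent vectors `w`, the fibre being
identified with `V` by the trivialisation `b`. -/
def pointForm (α : HochschildForm I L) (m n : ℕ) (b : L.ι) (φ : Module.Dual ℝ V)
    (a : Fin n → V) (y : M) (w : Fin m → E) : ℝ :=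
  φ (L.triv b y (α m n y w fun i => (L.triv b y).symm (a i)))

theorem localForm_extChartAt (α : HochschildForm I L) (m n : ℕ) (b : L.ι) {x y : M}
    (φ : Module.Dual ℝ V) (a : Fin n → V) (v : Fin m → E) (hy : y ∈ (extChartAt I x).source) :
    localForm α m n b x φ a (extChartAt I x y) v = pointForm α m n b φ a y fun i =>
      mfderivWithin 𝓘(ℝ, E) I (extChartAt I x).symm (Set.range I) (extChartAt I x y) (v i) := by
  change pointForm α m n b φ a ((extChartAt I x).symm (extChartAt I x y)) _ = _
  rw [(extChartAt I x).left_inv hy]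

theorem isLinearMap_localForm (α : HochschildForm I L) (n : ℕ) (b : L.ι) (x : M)
    (φ : Module.Dual ℝ V) (a : Fin n → V) (e : E) :
    IsLinearMap ℝ fun v : E => localForm α 1 n b x φ a e fun _ => v := by
  set y := (extChartAt I x).symm e
  let ℓ : E →ₗ[ℝ] MultilinearMap ℝ (fun _ : Fin n => L.fiber y) (L.fiber y) :=
    (AlternatingMap.ofSubsingleton ℝ E _ (0 : Fin 1)).symm (α 1 n y)
  let D : E →L[ℝ] E := mfderivWithin 𝓘(ℝ, E) I (extChartAt I x).symm (Set.range I) e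
  have hℓ (v : E) : localForm α 1 n b x φ a e (fun _ => v) =
      φ (L.triv b y (ℓ (D v) fun i => (L.triv b y).symm (a i))) := rfl
  constructor <;> intros <;> simp [hℓ]

variable (ψ : FlatTrivialization L γ)

/-- The transition from the trivialisation `ψ` along the path to the trivialisation `b`, at time
`t`. -/
def FlatTrivialization.transition (b : L.ι) (t : ℝ) : V ≃ₗ[ℝ] V :=
  (ψ.toEquiv t).symm.trans (L.triv b (γ t))

namespace FlatTrivialization

theorem triv_symm_transition (b : L.ι) (t : ℝ) (v : V) :
    (L.triv b (γ t)).symm (ψ.transition b t v) = (ψ.toEquiv t).symm v :=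
  LinearEquiv.symm_apply_apply _ _

theorem transition_symm_triv (b : L.ι) (t : ℝ) (z : L.fiber (γ t)) :
    (ψ.transition b t).symm (L.triv b (γ t) z) = ψ.toEquiv t z := by
  simp [transition]

theorem isGradedEquiv_transition {b : L.ι} {t : ℝ} (ht : t ∈ Set.Icc (0 : ℝ) 1)
    (hb : γ t ∈ L.baseSet b) : IsGradedEquiv 𝒱 𝒱 (ψ.transition b t) := fun i v => by
  rw [transition, LinearEquiv.trans_apply, L.triv_mem_iff b _ hb, ← ψ.mem_iff t ht,
    LinearEquiv.apply_symm_apply]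

theorem eventually_transition_eq {b : L.ι} {t : ℝ} (ht : t ∈ Set.Icc (0 : ℝ) 1)
    (hb : γ t ∈ L.baseSet b) :
    ∀ᶠ s in 𝓝[Set.Icc (0 : ℝ) 1] t, ψ.transition b s = ψ.transition b t := by
  filter_upwards [ψ.flat b t ht hb] with s hs using LinearEquiv.ext hs

end FlatTrivialization

/-- The multilinear map `α^{m,n}` at `γ t` on the tangent vectors `w`, in the trivialisation `ψ`. -/
def pathForm (α : HochschildForm I L) (m n : ℕ) (t : ℝ) (w : Fin m → TangentSpace I (γ t)) :
    MultilinearMap ℝ (fun _ : Fin n => V) V :=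
  conj (ψ.toEquiv t) (ψ.toEquiv t) (α m n (γ t) w)

theorem dual_pathForm (α : HochschildForm I L) (m n : ℕ) (b : L.ι) (t : ℝ)
    (w : Fin m → TangentSpace I (γ t)) (φ : Module.Dual ℝ V) (a : Fin n → V) :
    φ (pathForm ψ α m n t w a) =
      pointForm α m n b (φ ∘ₗ (ψ.transition b t).symm.toLinearMap)
        (fun i => ψ.transition b t (a i)) (γ t) w := by
  simp only [pathForm, pointForm, conj_apply, LinearMap.comp_apply, LinearEquiv.coe_coe,
    ψ.triv_symm_transition, ψ.transition_symm_triv]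

theorem eventually_dual_pathForm_eq_localForm (α : HochschildForm I L) {t : ℝ}
    (hγ : ContinuousWithinAt γ (Set.Icc 0 1) t) (ht : t ∈ Set.Icc (0 : ℝ) 1) {b : L.ι}
    (hb : γ t ∈ L.baseSet b) :
    ∀ᶠ s in 𝓝[Set.Icc (0 : ℝ) 1] t, γ s ∈ (extChartAt I (γ t)).source ∧
      ∀ (m n : ℕ) (v : Fin m → E) (φ : Module.Dual ℝ V) (a : Fin n → V),
        φ (pathForm ψ α m n s (fun i => mfderivWithin 𝓘(ℝ, E) I (extChartAt I (γ t)).symm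
            (Set.range I) (extChartAt I (γ t) (γ s)) (v i)) a) =
          localForm α m n b (γ t) (φ ∘ₗ (ψ.transition b t).symm.toLinearMap)
            (fun i => ψ.transition b t (a i)) (extChartAt I (γ t) (γ s)) v := by
  filter_upwards [hγ (extChartAt_source_mem_nhds (I := I) (γ t)),
    ψ.eventually_transition_eq ht hb] with s hchart htrans
  refine ⟨hchart, fun m n v φ a => ?_⟩
  rw [localForm_extChartAt α m n b _ _ v hchart, ← htrans]
  exact dual_pathForm ψ α m n b s _ φ a

end Paths

section MaurerCartan

variable {E : Type*} [NormedAddCommGroup E] [NormedSpace ℝ E]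
  {H : Type*} [TopologicalSpace H] {I : ModelWithCorners ℝ E H}
  {M : Type*} [TopologicalSpace M] [ChartedSpace H M]
  {V : Type*} [AddCommGroup V] [Module ℝ V] {𝒱 : ℤ → Submodule ℝ V}
  {L : LocalSystem M 𝒱} {α : HochschildForm I L} {γ : ℝ → M} (ψ : FlatTrivialization L γ)

theorem contDiffWithinAt_extChartAt_comp {s : Set ℝ} {t : ℝ}
    (hγ : ContMDiffWithinAt 𝓘(ℝ, ℝ) I 1 γ s t) :
    ContDiffWithinAt ℝ 1 (extChartAt I (γ t) ∘ γ) s t :=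
  (contMDiffWithinAt_iff_target.1 hγ).2.contDiffWithinAt

theorem mapsTo_extChartAt_comp_range (γ : ℝ → M) (x : M) (s : Set ℝ) :
    Set.MapsTo (extChartAt I x ∘ γ) s (Set.range I) :=
  fun _ _ => Set.mem_range_self _

theorem continuousWithinAt_localForm_derivWithin [FiniteDimensional ℝ E]
    (hα : IsSmooth α) {t : ℝ} (hγ : ContMDiffWithinAt 𝓘(ℝ, ℝ) I 1 γ (Set.Icc 0 1) t)
    (ht : t ∈ Set.Icc (0 : ℝ) 1) {n : ℕ} {b : L.ι} (hb : γ t ∈ L.baseSet b)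
    (φ : Module.Dual ℝ V) (a : Fin n → V) :
    ContinuousWithinAt (fun s => localForm α 1 n b (γ t) φ a (extChartAt I (γ t) (γ s))
      fun _ => derivWithin (extChartAt I (γ t) ∘ γ) (Set.Icc 0 1) s) (Set.Icc 0 1) t := by
  set c := extChartAt I (γ t) ∘ γ
  have hc : ContDiffWithinAt ℝ 1 c (Set.Icc 0 1) t := contDiffWithinAt_extChartAt_comp hγ
  have hc' : ContinuousWithinAt (derivWithin c (Set.Icc 0 1)) (Set.Icc 0 1) t :=
    (hc.derivWithin (m := 0) (uniqueDiffOn_Icc zero_lt_one) (by norm_num) ht).continuousWithinAt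
  let B := Module.finBasis ℝ E
  have hexpand (s : ℝ) :
      localForm α 1 n b (γ t) φ a (c s) (fun _ => derivWithin c (Set.Icc 0 1) s) =
        ∑ k, B.coord k (derivWithin c (Set.Icc 0 1) s) *
          localForm α 1 n b (γ t) φ a (c s) fun _ => B k := by
    have hlin := isLinearMap_localForm α n b (γ t) φ a (c s)
    have hsum := congrArg (hlin.mk' _) (B.sum_repr (derivWithin c (Set.Icc 0 1) s))
    simpa only [map_sum, map_smul, IsLinearMap.mk'_apply, smul_eq_mul,
      ← B.coord_apply] using hsum.symm
  have hcoeff (k) : ContinuousWithinAt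
      (fun s => localForm α 1 n b (γ t) φ a (c s) fun _ => B k) (Set.Icc 0 1) t :=
    (hα 1 n b (γ t) hb φ a fun _ => B k).continuousWithinAt.comp (f := c) hc.continuousWithinAt
      (mapsTo_extChartAt_comp_range γ _ _)
  refine ContinuousWithinAt.congr (tendsto_finsetSum _ fun k _ => ?_) (fun s _ => hexpand s)
    (hexpand t)
  exact ((B.coord k).continuous_of_finiteDimensional.continuousAt.comp_continuousWithinAt
    hc').mul (hcoeff k)

theorem weaklyContinuousOn_pullbackOne [FiniteDimensional ℝ E] [IsManifold I 1 M]
    (hα : IsSmooth α) (hγ : ContMDiffOn 𝓘(ℝ, ℝ) I 1 γ (Set.Icc 0 1)) (n : ℕ) (a : Fin n → V) :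
    WeaklyContinuousOn (fun t => pullbackOne α γ ψ t n a) (Set.Icc 0 1) := by
  intro φ t ht
  obtain ⟨b, hb⟩ := L.exists_mem_baseSet (γ t)
  have hlocal : ∀ᶠ s in 𝓝[Set.Icc (0 : ℝ) 1] t, φ (pullbackOne α γ ψ s n a) =
      localForm α 1 n b (γ t) (φ ∘ₗ (ψ.transition b t).symm.toLinearMap)
        (fun i => ψ.transition b t (a i)) (extChartAt I (γ t) (γ s))
        fun _ => derivWithin (extChartAt I (γ t) ∘ γ) (Set.Icc 0 1) s := by
    filter_upwards [eventually_dual_pathForm_eq_localForm ψ α (hγ.continuousOn t ht) ht hb,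
      self_mem_nhdsWithin] with s ⟨hchart, hform⟩ hs
    rw [← hform, mfderivWithin_extChartAt_symm_derivWithin
      ((hγ s hs).mdifferentiableWithinAt one_ne_zero) hs hchart]
    rfl
  exact (continuousWithinAt_localForm_derivWithin hα (hγ t ht) ht hb _ _).congr_of_eventuallyEq
    hlocal (hlocal.self_of_nhdsWithin ht)

theorem isConnection_pullbackOne [FiniteDimensional ℝ E] [IsManifold I 1 M] (hα : IsSmooth α)
    (h11 : ∀ x, α 1 1 x = 0) (hγ : ContMDiffOn 𝓘(ℝ, ℝ) I 1 γ (Set.Icc 0 1)) :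
    IsConnection (fun t => listEval (pullbackOne α γ ψ t)) (Set.Icc 0 1) where
  isListMultilinear _ _ := isListMultilinear_listEval _
  weaklyContinuousOn l := weaklyContinuousOn_pullbackOne ψ hα hγ l.length l.get
  unary_eq_zero t _ x := by
    change ψ.toEquiv t (α 1 1 (γ t) _ _) = 0
    rw [h11]
    exact map_zero _

theorem isHomogeneous_pullbackOne (hα : IsMaurerCartan α) {t : ℝ} (ht : t ∈ Set.Icc (0 : ℝ) 1)
    (n : ℕ) : IsHomogeneous 𝒱 𝒱 (pullbackOne α γ ψ t n) (1 - n) := by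
  have h := (hα.homogeneous 1 n (γ t) fun _ => velocity I γ t).conj (ψ.mem_iff t ht)
    (ψ.mem_iff t ht)
  rwa [show (2 : ℤ) - (1 : ℕ) - n = 1 - n by push_cast; ring] at h

/-- The operation `μ^n` over `γ t`, in the trivialisation `ψ`. -/
def pathMaps (α : HochschildForm I L) (t : ℝ) (n : ℕ) : MultilinearMap ℝ (fun _ : Fin n => V) V :=
  conj (ψ.toEquiv t) (ψ.toEquiv t) (structureMaps α (γ t) n)

theorem pathMaps_eq_pathForm (α : HochschildForm I L) (t : ℝ) (n : ℕ)
    (w : Fin 0 → TangentSpace I (γ t)) : pathMaps ψ α t n = pathForm ψ α 0 n t w := by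
  rw [pathMaps, pathForm, eq_structureMaps]

theorem hasDerivWithinAt_dual_pathMaps [IsManifold I 1 M] (hα : IsSmooth α) {t : ℝ}
    (hγ : ContMDiffWithinAt 𝓘(ℝ, ℝ) I 1 γ (Set.Icc 0 1) t) (ht : t ∈ Set.Icc (0 : ℝ) 1) {b : L.ι}
    (hb : γ t ∈ L.baseSet b) (n : ℕ) (φ : Module.Dual ℝ V) (a : Fin n → V) :
    HasDerivWithinAt (fun s => φ (pathMaps ψ α s n a))
      (covariantDeriv α 1 n b (γ t) (φ ∘ₗ (ψ.transition b t).symm.toLinearMap)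
        (fun i => ψ.transition b t (a i)) fun _ => velocity I γ t) (Set.Icc 0 1) t := by
  set φ' := φ ∘ₗ (ψ.transition b t).symm.toLinearMap
  set a' := fun i => ψ.transition b t (a i)
  set c := extChartAt I (γ t) ∘ γ with hc_def
  have hc : HasDerivWithinAt c (derivWithin c (Set.Icc 0 1) t) (Set.Icc 0 1) t :=
    ((contDiffWithinAt_extChartAt_comp hγ).differentiableWithinAt one_ne_zero).hasDerivWithinAt
  have hlocal : ∀ᶠ s in 𝓝[Set.Icc (0 : ℝ) 1] t, φ (pathMaps ψ α s n a) =
      localForm α 0 n b (γ t) φ' a' (c s) Fin.elim0 := by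
    filter_upwards [eventually_dual_pathForm_eq_localForm ψ α hγ.continuousWithinAt ht hb]
      with s ⟨_, hform⟩
    rw [hc_def, Function.comp_apply, ← hform]
    exact congrArg (fun f => φ (f a)) (pathMaps_eq_pathForm ψ α s n _)
  have hderiv := ((hα 0 n b (γ t) hb φ' a' Fin.elim0).differentiableWithinAt
    (by simp)).hasFDerivWithinAt.comp_hasDerivWithinAt t hc (mapsTo_extChartAt_comp_range γ _ _)
  refine (hderiv.congr_of_eventuallyEq hlocal (hlocal.self_of_nhdsWithin ht)).congr_deriv ?_
  rw [covariantDeriv, Fintype.sum_subsingleton _ (0 : Fin 1), Fin.val_zero, pow_zero, one_mul,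
    mfderiv_extChartAt_velocity (hγ.mdifferentiableWithinAt one_ne_zero) ht
      (mem_extChartAt_source _)]
  congr! 4

theorem conj_selfBracket_one (α : HochschildForm I L) (h00 : ∀ x, α 0 0 x = 0)
    (h10 : ∀ x, α 1 0 x = 0) (t : ℝ) (n : ℕ) (deg : ℕ → ℤ) (a : ℕ → V) :
    ψ.toEquiv t (selfBracket α 1 n (γ t) (fun _ => velocity I γ t) deg
      fun i => (ψ.toEquiv t).symm (a i)) = (2 : ℝ) •
        (∑ m ∈ Finset.Icc 1 n, gComp (pullbackOne α γ ψ t (n - m + 1)) (pathMaps ψ α t m) 1 deg a -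
          ∑ m ∈ Finset.Icc 1 n,
            gComp (pathMaps ψ α t (n - m + 1)) (pullbackOne α γ ψ t m) 0 deg a) := by
  have hμ : pathMaps ψ α t 0 = 0 := by
    ext a
    simp [pathMaps, structureMaps, conj_apply, h00]
  have hA : pullbackOne α γ ψ t 0 = 0 := by
    ext a
    simp [pullbackOne, h10]
  rw [selfBracket_one, ← sum_antidiagonal_gComp _ hμ, ← sum_antidiagonal_gComp _ hA, map_smul,
    map_sub, map_sum, map_sum]
  simp only [← gComp_conj]
  rfl

theorem hasWeakDerivOn_pathMaps [IsManifold I 1 M] (hα : IsMaurerCartan α)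
    (h00 : ∀ x, α 0 0 x = 0) (h10 : ∀ x, α 1 0 x = 0)
    (hγ : ContMDiffOn 𝓘(ℝ, ℝ) I 1 γ (Set.Icc 0 1)) (n : ℕ) {deg : ℕ → ℤ} {a : ℕ → V}
    (ha : ∀ i, a i ∈ 𝒱 (deg i)) :
    HasWeakDerivOn (fun t => pathMaps ψ α t n fun i => a i)
      (fun t =>
        ∑ m ∈ Finset.Icc 1 n, gComp (pathMaps ψ α t (n - m + 1)) (pullbackOne α γ ψ t m) 0 deg a -
          ∑ m ∈ Finset.Icc 1 n,
            gComp (pullbackOne α γ ψ t (n - m + 1)) (pathMaps ψ α t m) 1 deg a)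
      (Set.Icc 0 1) := by
  intro φ t ht
  obtain ⟨b, hb⟩ := L.exists_mem_baseSet (γ t)
  have hMC := hα.equation 1 n b (γ t) hb (φ ∘ₗ (ψ.transition b t).symm.toLinearMap) deg
    (fun i => ψ.transition b t (a i)) (fun i => (ψ.isGradedEquiv_transition ht hb _ _).2 (ha i))
    fun _ => velocity I γ t
  simp only [ψ.triv_symm_transition, LinearMap.comp_apply, LinearEquiv.coe_coe,
    ψ.transition_symm_triv, conj_selfBracket_one ψ α h00 h10, map_smul, smul_eq_mul,
    map_sub] at hMC
  refine (hasDerivWithinAt_dual_pathMaps ψ hα.smooth (hγ t ht) ht hb n φ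
    fun i => a i).congr_deriv ?_
  rw [map_sub]
  linarith

theorem isTreeIntegral_conj_treeTransport {a b p q : ℝ}
    (hA : IsConnection (fun t => listEval (pullbackOne α γ ψ t)) (Set.Icc a b))
    (hp : p ∈ Set.Icc a b) (hq : q ∈ Set.Icc a b) (d : ℕ) :
    IsTreeIntegral α γ ψ d p q fun n => conj (ψ.toEquiv p).symm (ψ.toEquiv q).symm
      ((isListMultilinear_treeTransport hA hp hq).toMultilinearMap n) := by
  intro n _ x φ
  simp only [conj_apply, LinearEquiv.apply_symm_apply, LinearEquiv.symm_symm,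
    ← listTreeSum_listOfSeq]
  exact dual_treeTransport hA hp hq ((List.length_ofFn ..).trans_le (Nat.le_add_right n d)) φ

end MaurerCartan

end AInfFamily

end

theorem mainTheorem2_general
    {E : Type*} [NormedAddCommGroup E] [NormedSpace ℝ E] [FiniteDimensional ℝ E]
    {H : Type*} [TopologicalSpace H] (I : ModelWithCorners ℝ E H)
    {M : Type*} [TopologicalSpace M] [ChartedSpace H M] [IsManifold I 1 M]
    {V : Type*} [AddCommGroup V] [Module ℝ V] (𝒱 : ℤ → Submodule ℝ V)
    (h𝒱 : DirectSum.IsInternal 𝒱)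
    (L : AInfFamily.LocalSystem M 𝒱)
    (α : AInfFamily.HochschildForm I L) (hα : AInfFamily.IsMaurerCartan α)
    (h00 : ∀ x, α 0 0 x = 0) (h10 : ∀ x, α 1 0 x = 0) (h11 : ∀ x, α 1 1 x = 0)
    (γ : ℝ → M) (hγ : ContMDiffOn 𝓘(ℝ, ℝ) I 1 γ (Set.Icc 0 1))
    (ψ : AInfFamily.FlatTrivialization L γ)
    (p q : ℝ) (hp : p ∈ Set.Icc (0 : ℝ) 1) (hq : q ∈ Set.Icc (0 : ℝ) 1) :
    ∃ F : ∀ n, MultilinearMap ℝ (fun _ : Fin n => L.fiber (γ p)) (L.fiber (γ q)),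
      (∀ d, AInfFamily.IsTreeIntegral α γ ψ d p q F) ∧
      AInfFamily.IsAInfMorphism (L.grading (γ p)) (L.grading (γ q))
        (AInfFamily.structureMaps α (γ p)) (AInfFamily.structureMaps α (γ q)) F := by
  open AInfFamily in
  have hA := isConnection_pullbackOne ψ hα.smooth h11 hγ
  have hgraded (t) (ht : t ∈ Set.Icc (0 : ℝ) 1) :
      IsGradedEquiv (L.grading (γ t)) 𝒱 (ψ.toEquiv t) := ψ.mem_iff t ht
  have halg (t) (ht : t ∈ Set.Icc (0 : ℝ) 1) : IsAInfAlgebra 𝒱 (pathMaps ψ α t) :=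
    (isAInfAlgebra_structureMaps h𝒱 hα (γ t)).conj (hgraded t ht)
  have hmorphism := (isAInfMorphism_treeTransport hA
    (fun t ht => isHomogeneous_pullbackOne ψ hα ht)
    (fun n _ _ ha => hasWeakDerivOn_pathMaps ψ hα h00 h10 hγ n ha) hp hq (halg p hp)
    (halg q hq)).conj (hgraded p hp).symm (hgraded q hq).symm
  simp only [pathMaps, conj_symm_conj] at hmorphism
  exact ⟨_, isTreeIntegral_conj_treeTransport ψ hA hp hq, hmorphism⟩

theorem mainTheorem2
    {E : Type*} [NormedAddCommGroup E] [NormedSpace ℝ E] [FiniteDimensional ℝ E]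
    {H : Type*} [TopologicalSpace H] (I : ModelWithCorners ℝ E H)
    {M : Type*} [TopologicalSpace M] [ChartedSpace H M] [IsManifold I ∞ M]
    {V : Type*} [AddCommGroup V] [Module ℝ V] (𝒱 : ℤ → Submodule ℝ V)
    (h𝒱 : DirectSum.IsInternal 𝒱)
    (L : AInfFamily.LocalSystem M 𝒱)
    (α : AInfFamily.HochschildForm I L) (hα : AInfFamily.IsMaurerCartan α)
    (h00 : ∀ x, α 0 0 x = 0) (h10 : ∀ x, α 1 0 x = 0) (h20 : ∀ x, α 2 0 x = 0)
    (h11 : ∀ x, α 1 1 x = 0)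
    (γ : ℝ → M) (hγ : ContMDiffOn 𝓘(ℝ, ℝ) I 1 γ (Set.Icc 0 1))
    (ψ : AInfFamily.FlatTrivialization L γ)
    (d : ℕ) (p q : ℝ) (hp : p ∈ Set.Icc (0 : ℝ) 1) (hq : q ∈ Set.Icc (0 : ℝ) 1) :
    ∃ F : ∀ n, MultilinearMap ℝ (fun _ : Fin n => L.fiber (γ p)) (L.fiber (γ q)),
      AInfFamily.IsTreeIntegral α γ ψ d p q F ∧
      AInfFamily.IsAInfMorphism (L.grading (γ p)) (L.grading (γ q))
        (AInfFamily.structureMaps α (γ p)) (AInfFamily.structureMaps α (γ q)) F := by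
  have : IsManifold I 1 M := IsManifold.of_le (n := ∞) (by norm_cast)
  obtain ⟨F, hF, hmorphism⟩ :=
    mainTheorem2_general I 𝒱 h𝒱 L α hα h00 h10 h11 γ hγ ψ p q hp hq
  exact ⟨F, hF d, hmorphism⟩
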